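/- Notation. For a finite additive (abelian) group $Z$, an integer $s\ge 1$ and $g\colon Z\to\mathbb{R}$, let $$\|g\|_{U^s(Z)}=\Big(\frac{1}{|Z|^{s+1}}\sum_{x\in Z}\sum_{(h_1,\dots,h_s)\in Z^s}\ \prod_{\omega\in\{0,1\}^s} g\big(x+\omega_1h_1+\cdots+\omega_sh_s\big)\Big)^{1/2^s}$$ denote the Gowers uniformity norm of $g$. Write $[N]=\{1,\dots,N\}$ and $\mathbb{Z}_M=\mathbb{Z}/M\mathbb{Z}$; for $M>2N$ identify $[N]$ with a subset of $\mathbb{Z}_M$ in the obvious way. For $f\colon[N]\to\mathbb{R}$ let $$\|f\|_{U^s[N]}=\frac{\|f\mathbf{1}_{[N]}\|_{U^s(\mathbb{Z}_{M})}}{\|\mathbf{1}_{[N]}\|_{U^s(\mathbb{Z}_{M})}},$$ where $M>2N$ is an integer, $f\mathbf{1}_{[N]}$ is the extension of $f$ by zero and $\mathbf{1}_{[N]}$ is the indicator function of $[N]$; the value does not depend on the choice of $M>2N$. Corollary 5.5. For every integer $s\ge 2$, every real $C\ge 20$ and every $0<\varepsilon\le 1$ there exist a positive integer $N_0$ and a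 real $\eta>0$ with the following property. Let $N\ge N_0$ be an integer and let $N'\in[CN,2CN]$ be a prime. Let $\nu\colon\mathbb{Z}_{N'}\to[0,\infty)$ satisfy $$\|\nu-1\|_{U^{2s}(\mathbb{Z}_{N'})}\le\eta,$$ and let $f\colon[N]\to\mathbb{R}$ satisfy $|f(n)|\le\nu(n)$ for every $n\in[N]$. Then there exists a function $h\colon[N]\to[-1,1]$ such that $$\|f-h\|_{U^s[N]}\le\varepsilon.$$ Moreover, if $f$ is nonnegative, then $h$ can be taken to be nonnegative as well. -/

import Mathlib

open scoped BigOperators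

noncomputable section

/-- The Gowers uniformity norm `‖f‖_{U^s(Z)}` of a real-valued function on a finite additive
group `Z`: the `2^s`-th root of the average of `∏_{ω ∈ {0,1}^s} f (x + ω · h)` over all
`x ∈ Z` and `h ∈ Z^s`, where `ω · h = ∑ i, ω i • h i`. -/
def gowersNorm {Z : Type*} [AddCommGroup Z] [Fintype Z] (s : ℕ) (f : Z → ℝ) : ℝ :=
  (𝔼 p : Z × (Fin s → Z),
    ∏ ω : Fin s → Fin 2, f (p.1 + ∑ i, (ω i : ℕ) • p.2 i)) ^ (1 / (2 : ℝ) ^ s)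

/-- For `f : [N] → ℝ`, where `[N] = {1, …, N}`, the function `f 1_{[N]}` on `ℤ/Mℤ`: it extends
`f` by zero outside `[N]`. For `N < M` the interval `[N]` is identified with the set of residue
classes whose representative in `{0, …, M - 1}` lies in `[N]`. -/
def extendInterval {N : ℕ} (M : ℕ) (f : Finset.Icc 1 N → ℝ) (x : ZMod M) : ℝ :=
  if hx : x.val ∈ Finset.Icc 1 N then f ⟨x.val, hx⟩ else 0

/-- The Gowers uniformity norm `‖f‖_{U^s[N]}` of `f : [N] → ℝ` on the interval `[N]`, computed
in the cyclic group `ℤ/Mℤ`, where `M > 2 * N` (every such `M` gives the same value):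
`‖f 1_{[N]}‖_{U^s(ℤ/Mℤ)} / ‖1_{[N]}‖_{U^s(ℤ/Mℤ)}`. -/
def gowersIntervalNorm {N : ℕ} (M : ℕ) [NeZero M] (s : ℕ) (f : Finset.Icc 1 N → ℝ) : ℝ :=
  gowersNorm s (extendInterval M f) /
    gowersNorm s (extendInterval M (fun _ : Finset.Icc 1 N => (1 : ℝ)))

end

/-! The proof finds a bounded model `h` for which `f - h` is almost orthogonal to every dual
function of a system bounded by 1, and then upgrades this weak orthogonality to smallness of the
Gowers norm.

Model (`exists_dense_model`). Sion's minimax theorem produces `0 ≤ g ≤ J` close to `f` unless some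
`φ` in the closed convex hull of dual functions makes `𝔼 f φ` exceed `𝔼 J max(φ, 0)` noticeably. To
exclude this, `max(φ, 0)` is replaced by a polynomial in `φ`. The hull is closed under products
(`mul_mem_dualHull`), so `ν - 1` is nearly orthogonal to such polynomials without any uniformity of
higher order. Taking `J` to be the indicator of `[N]` keeps the model supported on `[N]`; this `J`
is approximated from above, in mean, by a multiple of a dual function (`exists_interval_majorant`),
a construction that uses two directions and so `s ≥ 2`.

Densification (`exists_forall_abs_cubeAvg_le`). In the cube average of `(f - h) / 2`, which is
majorised by `(ν + 1) / 2`, the unbounded factors are made bounded one at a time. Cauchy–Schwarz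
with weight `ν` leaves the second moment of a dual function `D`. The square of `D` lives on a cube
of dimension `2s` (`cubeAvg_glueAtOrigin`), and there the `U^{2s}` hypothesis removes the weight.
Truncating `D` to `[-1, 1]` is cheap because its majorant is close to 1 in mean square, and the
truncation is a bounded factor. Once a single unbounded factor is left, weak orthogonality applies.
-/

/-! ### Cube averages and the Gowers–Cauchy–Schwarz inequality. -/

section CubeAverages

variable {ι κ Z : Type*} [Fintype ι] [DecidableEq ι] [Fintype κ] [DecidableEq κ]
  [AddCommGroup Z] [Fintype Z]

/-- The average of `∏ ω, F ω (x + ω · h)` over all parallelepipeds `(x, h)` in `Z`. -/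
noncomputable def cubeAvg (F : (ι → Fin 2) → Z → ℝ) : ℝ :=
  𝔼 p : Z × (ι → Z), ∏ ω : ι → Fin 2, F ω (p.1 + ∑ i, (ω i : ℕ) • p.2 i)

theorem gowersNorm_eq_cubeAvg (s : ℕ) (f : Z → ℝ) :
    gowersNorm s f = cubeAvg (fun _ : Fin s → Fin 2 => f) ^ (1 / (2 : ℝ) ^ s) := rfl

theorem cubeAvg_comp_equiv (e : ι ≃ κ) (F : (ι → Fin 2) → Z → ℝ) :
    cubeAvg (fun ω : κ → Fin 2 => F (ω ∘ e)) = cubeAvg F := by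
  unfold cubeAvg
  refine Fintype.expect_equiv ((Equiv.refl Z).prodCongr (e.symm.arrowCongr (Equiv.refl Z))) _ _ ?_
  rintro ⟨x, h⟩
  refine Fintype.prod_equiv (e.symm.arrowCongr (Equiv.refl (Fin 2))) _ _ ?_
  intro ω
  have : ∑ i, (ω i : ℕ) • h i = ∑ i, (ω (e i) : ℕ) • h (e i) :=
    (e.sum_comp (fun i => (ω i : ℕ) • h i)).symm
  simp [Equiv.arrowCongr, this]

/-- Moving the base point to the vertex `τ` and reversing the directions in its support permutes the
parallelepipeds. Any vertex can thus be brought to the origin. -/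
theorem cubeAvg_reflect (τ : ι → Fin 2) (F : (ι → Fin 2) → Z → ℝ) :
    cubeAvg (fun ω => F (ω + τ)) = cubeAvg F := by
  unfold cubeAvg
  let R : Z × (ι → Z) → Z × (ι → Z) := fun p =>
    (p.1 + ∑ i, (τ i : ℕ) • p.2 i, fun i => if τ i = 0 then p.2 i else - p.2 i)
  have hR : Function.Involutive R := by
    rintro ⟨x, h⟩
    refine Prod.ext ?_ ?_
    · simp only [R]
      rw [add_assoc, ← Finset.sum_add_distrib, Finset.sum_eq_zero, add_zero]
      intro i _
      by_cases hi : τ i = 0 <;> simp [hi]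
    · funext i
      by_cases hi : τ i = 0 <;> simp [R, hi]
  have hττ : ∀ ω : ι → Fin 2, ω + τ + τ = ω := by
    intro ω
    funext i
    have : ∀ a b : Fin 2, a + b + b = a := by decide
    exact this _ _
  refine Fintype.expect_equiv (Function.Involutive.toPerm R hR) _ _ ?_
  rintro ⟨x, h⟩
  refine Fintype.prod_equiv (Equiv.addRight τ) _ _ ?_
  intro ω
  simp only [Equiv.coe_addRight, Function.Involutive.coe_toPerm, R]
  congr 1
  rw [add_assoc, ← Finset.sum_add_distrib]
  congr 1
  refine Finset.sum_congr rfl fun i _ => ?_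
  have h2 : ∀ a : Fin 2, a = 0 ∨ a = 1 := by decide
  have h11 : (1 + 1 : Fin 2) = 0 := by decide
  rcases h2 (ω i) with ha | ha <;> rcases h2 (τ i) with hb | hb <;> simp [ha, hb, h11]

/-- The product over the face `ω j = b` of the cube with base point `x` and directions `h`. -/
noncomputable def faceProd (F : (ι → Fin 2) → Z → ℝ) (j : ι) (b : Fin 2) (h : {i // i ≠ j} → Z)
    (x : Z) : ℝ :=
  ∏ η : {i // i ≠ j} → Fin 2,
    F ((Equiv.funSplitAt j (Fin 2)).symm (b, η)) (x + ∑ i, (η i : ℕ) • h i)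

/-- With the other directions fixed, `x` and `x + h j` are independent uniform points, so the two
opposite faces decouple. -/
theorem cubeAvg_eq_expect_faceProd (F : (ι → Fin 2) → Z → ℝ) (j : ι) :
    cubeAvg F = 𝔼 h : {i // i ≠ j} → Z,
      (𝔼 x, faceProd F j 0 h x) * (𝔼 x, faceProd F j 1 h x) := by
  have h1 : cubeAvg F = 𝔼 q : Z × (Z × ({i // i ≠ j} → Z)),
      faceProd F j 0 q.2.2 q.1 * faceProd F j 1 q.2.2 (q.1 + q.2.1) := by
    unfold cubeAvg
    refine Fintype.expect_equiv ((Equiv.refl Z).prodCongr (Equiv.funSplitAt j Z)) _ _ ?_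
    rintro ⟨x, h⟩
    rw [← (Equiv.funSplitAt j (Fin 2)).symm.prod_comp, Fintype.prod_prod_type, Fin.prod_univ_two]
    unfold faceProd
    have hsum : ∀ (b : Fin 2) (η : {i // i ≠ j} → Fin 2),
        ∑ i, (((Equiv.funSplitAt j (Fin 2)).symm (b, η) i : Fin 2) : ℕ) • h i
          = (b : ℕ) • h j + ∑ i : {i // i ≠ j}, (η i : ℕ) • h i := by
      intro b η
      rw [Fintype.sum_eq_add_sum_subtype_ne _ j]
      congr 1
      · simp [Equiv.funSplitAt, Equiv.piSplitAt]
      · refine Finset.sum_congr rfl fun i _ => ?_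
        simp [Equiv.funSplitAt, Equiv.piSplitAt, i.2]
    simp only [hsum]
    simp [Equiv.funSplitAt, Equiv.piSplitAt, add_assoc]
  rw [h1]
  have h2 : ∀ G : Z → Z → ({i // i ≠ j} → Z) → ℝ,
      (𝔼 q : Z × (Z × ({i // i ≠ j} → Z)), G q.1 q.2.1 q.2.2) = 𝔼 h, 𝔼 x, 𝔼 t, G x t h := by
    intro G
    rw [← Finset.univ_product_univ, Finset.expect_product]
    simp only [← Finset.univ_product_univ, Finset.expect_product]
    rw [Finset.expect_comm]
    conv_rhs => rw [Finset.expect_comm]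
    rw [Finset.expect_comm]
    refine Finset.expect_congr rfl fun x _ => ?_
    rw [Finset.expect_comm]
  rw [h2 (fun x t h => faceProd F j 0 h x * faceProd F j 1 h (x + t))]
  refine Finset.expect_congr rfl fun h _ => ?_
  rw [Finset.expect_mul]
  refine Finset.expect_congr rfl fun x _ => ?_
  rw [← Finset.mul_expect]
  congr 1
  exact Fintype.expect_equiv (Equiv.addLeft x) _ _ (fun t => rfl)

omit [Fintype Z] in
theorem faceProd_update (F : (ι → Fin 2) → Z → ℝ) (j : ι) (b c : Fin 2) (h : {i // i ≠ j} → Z)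
    (x : Z) : faceProd (fun ω => F (Function.update ω j b)) j c h x = faceProd F j b h x := by
  unfold faceProd
  refine Finset.prod_congr rfl fun η _ => ?_
  have : Function.update ((Equiv.funSplitAt j (Fin 2)).symm (c, η)) j b
      = (Equiv.funSplitAt j (Fin 2)).symm (b, η) := by
    funext i
    by_cases hi : i = j
    · subst hi; simp [Equiv.funSplitAt, Equiv.piSplitAt]
    · simp [Equiv.funSplitAt, Equiv.piSplitAt, hi]
  simp only [this]

theorem cubeAvg_update_eq (F : (ι → Fin 2) → Z → ℝ) (j : ι) (b : Fin 2) :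
    cubeAvg (fun ω => F (Function.update ω j b)) =
      𝔼 h : {i // i ≠ j} → Z, (𝔼 x, faceProd F j b h x) ^ 2 := by
  rw [cubeAvg_eq_expect_faceProd _ j]
  simp only [faceProd_update, sq]

theorem cubeAvg_update_nonneg (F : (ι → Fin 2) → Z → ℝ) (j : ι) (b : Fin 2) :
    0 ≤ cubeAvg (fun ω => F (Function.update ω j b)) := by
  rw [cubeAvg_update_eq]
  exact Finset.expect_nonneg fun _ _ => sq_nonneg _

theorem cubeAvg_const_nonneg [Nonempty ι] (f : Z → ℝ) :
    0 ≤ cubeAvg (fun _ : ι → Fin 2 => f) :=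
  cubeAvg_update_nonneg (fun _ : ι → Fin 2 => f) (Classical.arbitrary ι) 0

theorem cubeAvg_sq_le (F : (ι → Fin 2) → Z → ℝ) (j : ι) :
    cubeAvg F ^ 2 ≤ cubeAvg (fun ω => F (Function.update ω j 0)) *
      cubeAvg (fun ω => F (Function.update ω j 1)) := by
  rw [cubeAvg_update_eq, cubeAvg_update_eq, cubeAvg_eq_expect_faceProd F j]
  exact Finset.expect_mul_sq_le_sq_mul_sq _ _ _

/-- The Gowers–Cauchy–Schwarz inequality. -/
theorem abs_cubeAvg_pow_le [Nonempty ι] (F : (ι → Fin 2) → Z → ℝ) :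
    |cubeAvg F| ^ (2 ^ Fintype.card ι) ≤
      ∏ ω : ι → Fin 2, cubeAvg (fun _ : ι → Fin 2 => F ω) := by
  -- `S` collects the directions in which Cauchy–Schwarz has been applied; `b` records which face
  -- was kept in each of them.
  have key : ∀ S : Finset ι, |cubeAvg F| ^ (2 ^ Fintype.card ι) ≤
      ∏ b : ι → Fin 2, |cubeAvg (fun ω => F (S.piecewise b ω))| := by
    intro S
    induction S using Finset.induction_on with
    | empty => simp
    | insert j S hj ih =>
      refine ih.trans ?_
      set c : (ι → Fin 2) → ℝ := fun b => cubeAvg (fun ω => F ((insert j S).piecewise b ω)) with hc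
      have hpw : ∀ (b : ι → Fin 2) (d : Fin 2) (ω : ι → Fin 2),
          S.piecewise b (Function.update ω j d)
            = (insert j S).piecewise (Function.update b j d) ω := by
        intro b d ω
        funext i
        by_cases hi : i = j
        · subst hi; simp [Finset.piecewise, hj]
        · simp [Finset.piecewise, hi]
      have hsq : ∀ b, cubeAvg (fun ω => F (S.piecewise b ω)) ^ 2 ≤
          c (Function.update b j 0) * c (Function.update b j 1) := by
        intro b
        have := cubeAvg_sq_le (fun ω => F (S.piecewise b ω)) j
        simpa only [hpw] using this
      have hflip : Function.Involutive
          (fun b : ι → Fin 2 => Function.update b j (b j + 1)) := by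
        intro b
        have : ∀ a : Fin 2, a + 1 + 1 = a := by decide
        simp [this]
      -- Each `b` is paired with its neighbour across direction `j`, so multiplying over all `b`
      -- counts every factor twice and gives the square of the product.
      set e : Equiv.Perm (ι → Fin 2) := Function.Involutive.toPerm _ hflip with he
      have hpair : ∀ b : ι → Fin 2, c (Function.update b j 0) * c (Function.update b j 1) =
          c b * c (e b) := by
        intro b
        have h2 : ∀ a : Fin 2, a = 0 ∨ a = 1 := by decide
        have h11 : (1 + 1 : Fin 2) = 0 := by decide
        rcases h2 (b j) with hb | hb
        · have : Function.update b j 0 = b := by rw [← hb]; simp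
          simp [this, hb, he]
        · have : Function.update b j 1 = b := by rw [← hb]; simp
          simp [this, hb, he, h11, mul_comm]
      have hle : (∏ b, |cubeAvg (fun ω => F (S.piecewise b ω))|) ^ 2 ≤ (∏ b, |c b|) ^ 2 := by
        calc (∏ b, |cubeAvg (fun ω => F (S.piecewise b ω))|) ^ 2
            = ∏ b, cubeAvg (fun ω => F (S.piecewise b ω)) ^ 2 := by
              rw [← Finset.prod_pow]; simp only [sq_abs]
          _ ≤ ∏ b, (|c b| * |c (e b)|) := by
              refine Finset.prod_le_prod (fun _ _ => sq_nonneg _) fun b _ => ?_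
              rw [← abs_mul, ← hpair]
              exact (hsq b).trans (le_abs_self _)
          _ = (∏ b, |c b|) ^ 2 := by
              rw [Finset.prod_mul_distrib, Equiv.prod_comp e (fun b => |c b|), sq]
      exact (pow_le_pow_iff_left₀ (Finset.prod_nonneg fun _ _ => abs_nonneg _)
        (Finset.prod_nonneg fun _ _ => abs_nonneg _) two_ne_zero).1 hle
  have h := key Finset.univ
  simp only [Finset.piecewise_univ] at h
  simpa only [abs_of_nonneg (cubeAvg_const_nonneg (ι := ι) _)] using h

end CubeAverages

/-! ### Dual functions and two cubes glued at a vertex. -/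

section DualFunctions

variable {ι Z : Type*} [Fintype ι] [DecidableEq ι] [AddCommGroup Z] [Fintype Z]

theorem cubeAvg_mono {F V : (ι → Fin 2) → Z → ℝ} (h : ∀ ω x, |F ω x| ≤ V ω x) :
    |cubeAvg F| ≤ cubeAvg V := by
  unfold cubeAvg
  refine (Finset.abs_expect_le _ _).trans (Finset.expect_le_expect fun p _ => ?_)
  rw [Finset.abs_prod]
  exact Finset.prod_le_prod (fun _ _ => abs_nonneg _) fun ω _ => h ω _

@[simp] theorem cubeAvg_one : cubeAvg (fun _ : ι → Fin 2 => fun _ : Z => (1 : ℝ)) = 1 := by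
  simp [cubeAvg]

/-- The dual function `x ↦ 𝔼 h, ∏ ω ≠ 0, F ω (x + ω · h)`. -/
noncomputable def dualFun (F : (ι → Fin 2) → Z → ℝ) (x : Z) : ℝ :=
  𝔼 h : ι → Z, ∏ ω ∈ Finset.univ.erase (0 : ι → Fin 2), F ω (x + ∑ i, (ω i : ℕ) • h i)

theorem dualFun_congr {F G : (ι → Fin 2) → Z → ℝ} (h : ∀ ω, ω ≠ 0 → F ω = G ω) :
    dualFun F = dualFun G := by
  funext x
  refine Finset.expect_congr rfl fun _ _ => Finset.prod_congr rfl fun ω hω => ?_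
  rw [h ω (Finset.ne_of_mem_erase hω)]

theorem abs_dualFun_le {F V : (ι → Fin 2) → Z → ℝ} (h : ∀ ω, ω ≠ 0 → ∀ x, |F ω x| ≤ V ω x)
    (x : Z) : |dualFun F x| ≤ dualFun V x := by
  unfold dualFun
  refine (Finset.abs_expect_le _ _).trans (Finset.expect_le_expect fun p _ => ?_)
  rw [Finset.abs_prod]
  exact Finset.prod_le_prod (fun _ _ => abs_nonneg _)
    fun ω hω => h ω (Finset.ne_of_mem_erase hω) _

@[simp] theorem dualFun_one : dualFun (fun _ : ι → Fin 2 => fun _ : Z => (1 : ℝ)) = 1 := by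
  funext x
  simp [dualFun]

theorem abs_dualFun_le_one {F : (ι → Fin 2) → Z → ℝ} (h : ∀ ω x, |F ω x| ≤ 1) (x : Z) :
    |dualFun F x| ≤ 1 := by
  simpa using abs_dualFun_le (V := fun _ _ => 1) (fun ω _ => h ω) x

theorem cubeAvg_eq_expect_mul_dualFun (F : (ι → Fin 2) → Z → ℝ) :
    cubeAvg F = 𝔼 x, F 0 x * dualFun F x := by
  unfold cubeAvg dualFun
  rw [← Finset.univ_product_univ, Finset.expect_product]
  refine Finset.expect_congr rfl fun x _ => ?_
  rw [Finset.mul_expect]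
  refine Finset.expect_congr rfl fun h _ => ?_
  rw [← Finset.mul_prod_erase _ _ (Finset.mem_univ (0 : ι → Fin 2))]
  simp

/-- The system of functions on a doubled cube with `a` at the origin and with `F`, `G` on the
two coordinate faces through the origin. -/
def glueAtOrigin (a : Z → ℝ) (F G : (ι → Fin 2) → Z → ℝ) (ω : ι ⊕ ι → Fin 2) : Z → ℝ :=
  if ω ∘ Sum.inl = 0 then (if ω ∘ Sum.inr = 0 then a else G (ω ∘ Sum.inr))
  else (if ω ∘ Sum.inr = 0 then F (ω ∘ Sum.inl) else 1)

/-- For fixed `x` the two blocks of directions are independent. This is how a product of two dual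
functions becomes a cube average of doubled dimension. -/
theorem cubeAvg_glueAtOrigin (a : Z → ℝ) (F G : (ι → Fin 2) → Z → ℝ) :
    cubeAvg (glueAtOrigin a F G) = 𝔼 x, a x * (dualFun F x * dualFun G x) := by
  have h1 : cubeAvg (glueAtOrigin a F G) = 𝔼 q : Z × ((ι → Z) × (ι → Z)),
      a q.1 * ((∏ ω ∈ Finset.univ.erase (0 : ι → Fin 2), F ω (q.1 + ∑ i, (ω i : ℕ) • q.2.1 i)) *
        ∏ ω ∈ Finset.univ.erase (0 : ι → Fin 2), G ω (q.1 + ∑ i, (ω i : ℕ) • q.2.2 i)) := by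
    unfold cubeAvg
    refine Fintype.expect_equiv
      ((Equiv.refl Z).prodCongr (Equiv.sumArrowEquivProdArrow ι ι Z)) _ _ ?_
    rintro ⟨x, h⟩
    rw [← (Equiv.sumArrowEquivProdArrow ι ι (Fin 2)).symm.prod_comp, Fintype.prod_prod_type,
      ← Finset.mul_prod_erase _ _ (Finset.mem_univ (0 : ι → Fin 2)),
      ← Finset.mul_prod_erase _ _ (Finset.mem_univ (0 : ι → Fin 2))]
    have hl : ∀ p : (ι → Fin 2) × (ι → Fin 2),
        ((Equiv.sumArrowEquivProdArrow ι ι (Fin 2)).symm p) ∘ Sum.inl = p.1 := fun _ => rfl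
    have hr : ∀ p : (ι → Fin 2) × (ι → Fin 2),
        ((Equiv.sumArrowEquivProdArrow ι ι (Fin 2)).symm p) ∘ Sum.inr = p.2 := fun _ => rfl
    have hG : ∏ η ∈ Finset.univ.erase (0 : ι → Fin 2),
        glueAtOrigin a F G ((Equiv.sumArrowEquivProdArrow ι ι (Fin 2)).symm (0, η))
          (x + ∑ i, (((Equiv.sumArrowEquivProdArrow ι ι (Fin 2)).symm (0, η) i : Fin 2) : ℕ) • h i)
        = ∏ ω ∈ Finset.univ.erase (0 : ι → Fin 2),
          G ω (x + ∑ i, (ω i : ℕ) • h (Sum.inr i)) := by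
      refine Finset.prod_congr rfl fun η hη => ?_
      simp [glueAtOrigin, hl, hr, Finset.ne_of_mem_erase hη]
    have hF : ∏ η ∈ Finset.univ.erase (0 : ι → Fin 2), ∏ θ : ι → Fin 2,
        glueAtOrigin a F G ((Equiv.sumArrowEquivProdArrow ι ι (Fin 2)).symm (η, θ))
          (x + ∑ i, (((Equiv.sumArrowEquivProdArrow ι ι (Fin 2)).symm (η, θ) i : Fin 2) : ℕ) • h i)
        = ∏ ω ∈ Finset.univ.erase (0 : ι → Fin 2),
          F ω (x + ∑ i, (ω i : ℕ) • h (Sum.inl i)) := by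
      refine Finset.prod_congr rfl fun η hη => ?_
      rw [Fintype.prod_eq_single (0 : ι → Fin 2)]
      · simp [glueAtOrigin, hl, hr, Finset.ne_of_mem_erase hη]
      · intro θ hθ
        simp [glueAtOrigin, hl, hr, Finset.ne_of_mem_erase hη, hθ]
    rw [hG, hF]
    simp only [glueAtOrigin, hl, hr]
    simp [Equiv.sumArrowEquivProdArrow]
    ring
  rw [h1, ← Finset.univ_product_univ, Finset.expect_product]
  refine Finset.expect_congr rfl fun x _ => ?_
  dsimp only
  rw [← Finset.mul_expect]
  congr 1
  unfold dualFun
  rw [Finset.expect_mul_expect, ← Finset.univ_product_univ, Finset.expect_product]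

end DualFunctions

/-! ### Consequences of pseudorandomness of the majorant. -/

section Pseudorandom

variable {ι Z : Type*} [Fintype ι] [DecidableEq ι] [Nonempty ι] [AddCommGroup Z] [Fintype Z]

theorem abs_cubeAvg_le_of_factor {τ B : ℝ} (hτ : 0 ≤ τ) (hB : 1 ≤ B) (F : (ι → Fin 2) → Z → ℝ)
    (ω₀ : ι → Fin 2) (h₀ : cubeAvg (fun _ : ι → Fin 2 => F ω₀) ≤ τ ^ 2 ^ Fintype.card ι)
    (hF : ∀ ω, ω ≠ ω₀ → cubeAvg (fun _ : ι → Fin 2 => F ω) ≤ B) :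
    |cubeAvg F| ≤ τ * B := by
  have hB0 : 0 ≤ B := zero_le_one.trans hB
  have h1 := abs_cubeAvg_pow_le F
  rw [← Finset.mul_prod_erase _ _ (Finset.mem_univ ω₀)] at h1
  have hcard : (Finset.univ.erase ω₀).card ≤ 2 ^ Fintype.card ι := by
    refine (Finset.card_erase_le).trans ?_
    simp
  have h2 : ∏ ω ∈ Finset.univ.erase ω₀, cubeAvg (fun _ : ι → Fin 2 => F ω) ≤
      B ^ 2 ^ Fintype.card ι := by
    calc _ ≤ ∏ _ω ∈ Finset.univ.erase ω₀, B :=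
          Finset.prod_le_prod (fun _ _ => cubeAvg_const_nonneg _)
            fun ω hω => hF ω (Finset.ne_of_mem_erase hω)
      _ = B ^ (Finset.univ.erase ω₀).card := by simp
      _ ≤ _ := pow_le_pow_right₀ hB hcard
  have h3 : |cubeAvg F| ^ (2 ^ Fintype.card ι) ≤ (τ * B) ^ (2 ^ Fintype.card ι) := by
    rw [mul_pow]
    exact h1.trans (mul_le_mul h₀ h2 (Finset.prod_nonneg fun _ _ => cubeAvg_const_nonneg _)
      (pow_nonneg hτ _))
  exact (pow_le_pow_iff_left₀ (abs_nonneg _) (mul_nonneg hτ hB0) (by positivity)).1 h3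

omit [Nonempty ι] in
theorem cubeAvg_expand (g : (ι → Fin 2) → Z → ℝ) :
    cubeAvg (fun ω x => g ω x + 1) = ∑ S : Finset (ι → Fin 2),
      cubeAvg (fun ω => if ω ∈ S then g ω else fun _ => 1) := by
  unfold cubeAvg
  rw [← Finset.expect_sum_comm]
  refine Finset.expect_congr rfl fun p _ => ?_
  rw [Finset.prod_add_one, Finset.powerset_univ]
  refine Finset.sum_congr rfl fun S _ => ?_
  rw [← Finset.prod_subset (Finset.subset_univ S)]
  · exact Finset.prod_congr rfl fun ω hω => by simp [hω]
  · intro ω _ hω; simp [hω]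

/-- Expanding `V ω = 1 + (V ω - 1)` gives one term per set of vertices. The empty set gives 1; any
other term has a factor `ν - 1` or `0`, hence is at most `τ` by Gowers–Cauchy–Schwarz. -/
theorem abs_cubeAvg_sub_one_le {τ : ℝ} (hτ : 0 ≤ τ) (hτ1 : τ ≤ 1) {ν : Z → ℝ}
    (hν : cubeAvg (fun _ : ι → Fin 2 => fun x => ν x - 1) ≤ τ ^ 2 ^ Fintype.card ι)
    {V : (ι → Fin 2) → Z → ℝ} (hV : ∀ ω, V ω = ν ∨ V ω = 1) :
    |cubeAvg V - 1| ≤ 2 ^ 2 ^ Fintype.card ι * τ := by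
  have hV' : V = fun ω x => (fun ω x => V ω x - 1) ω x + 1 := by funext ω x; simp
  have hU : ∀ ω, cubeAvg (fun _ : ι → Fin 2 => fun x => V ω x - 1) ≤ τ ^ 2 ^ Fintype.card ι := by
    intro ω
    rcases hV ω with h | h
    · rw [h]; exact hν
    · rw [h]
      have : cubeAvg (fun _ : ι → Fin 2 => fun x : Z => (1 : Z → ℝ) x - 1) = 0 := by
        simp [cubeAvg]
      rw [this]; positivity
  rw [hV', cubeAvg_expand, ← Finset.add_sum_erase _ _ (Finset.mem_univ ∅)]
  have h0 : cubeAvg (fun ω : ι → Fin 2 => if ω ∈ (∅ : Finset (ι → Fin 2)) then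
      (fun x => V ω x - 1) else fun _ : Z => (1 : ℝ)) = 1 := by simp
  rw [h0, add_sub_cancel_left]
  refine (Finset.abs_sum_le_sum_abs _ _).trans ?_
  calc _ ≤ ∑ _S ∈ (Finset.univ.erase (∅ : Finset (ι → Fin 2))), τ := by
        refine Finset.sum_le_sum fun S hS => ?_
        obtain ⟨ω₀, hω₀⟩ := Finset.nonempty_of_ne_empty (Finset.ne_of_mem_erase hS)
        have := abs_cubeAvg_le_of_factor hτ le_rfl
          (fun ω => if ω ∈ S then (fun x => V ω x - 1) else fun _ : Z => (1 : ℝ)) ω₀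
          (by simpa [hω₀] using hU ω₀)
          (fun ω _ => by
            by_cases h : ω ∈ S
            · simpa [h] using (hU ω).trans (pow_le_one₀ hτ hτ1)
            · simp [h])
        simpa using this
    _ = (Finset.univ.erase (∅ : Finset (ι → Fin 2))).card * τ := by simp
    _ ≤ _ := by
        refine mul_le_mul_of_nonneg_right ?_ hτ
        have : (Finset.univ.erase (∅ : Finset (ι → Fin 2))).card ≤ 2 ^ 2 ^ Fintype.card ι :=
          (Finset.card_erase_le).trans (by simp)
        exact_mod_cast this

/-- In Gowers–Cauchy–Schwarz the factor `ν - 1` contributes `τ`, while the other norms are bounded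
by those of their majorants, which are close to 1. -/
theorem abs_cubeAvg_le_of_sub_one_factor {τ : ℝ} (hτ : 0 ≤ τ) (hτ1 : τ ≤ 1) {ν : Z → ℝ}
    (hν : cubeAvg (fun _ : ι → Fin 2 => fun x => ν x - 1) ≤ τ ^ 2 ^ Fintype.card ι)
    {F V : (ι → Fin 2) → Z → ℝ} (hV : ∀ ω, V ω = ν ∨ V ω = 1) (ω₀ : ι → Fin 2)
    (h₀ : F ω₀ = fun x => ν x - 1) (hF : ∀ ω, ω ≠ ω₀ → ∀ x, |F ω x| ≤ V ω x) :
    |cubeAvg F| ≤ τ * (1 + 2 ^ 2 ^ Fintype.card ι) := by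
  refine abs_cubeAvg_le_of_factor hτ (by simp) F ω₀ (by rw [h₀]; exact hν) fun ω hω => ?_
  have h1 := cubeAvg_mono (F := fun _ : ι → Fin 2 => F ω) (V := fun _ => V ω)
    (fun _ x => hF ω hω x)
  have h2 := abs_cubeAvg_sub_one_le hτ hτ1 hν (V := fun _ => V ω) (fun _ => hV ω)
  have h3 : (2 : ℝ) ^ 2 ^ Fintype.card ι * τ ≤ 2 ^ 2 ^ Fintype.card ι :=
    mul_le_of_le_one_right (by positivity) hτ1
  have h4 := (abs_le.1 h2).2
  linarith [le_abs_self (cubeAvg (fun _ : ι → Fin 2 => F ω))]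

variable {τ : ℝ} {ν : Z → ℝ}

omit [DecidableEq ι] [Nonempty ι] [AddCommGroup Z] [Fintype Z] in
theorem glueAtOrigin_eq_or {a : Z → ℝ} {V W : (ι → Fin 2) → Z → ℝ} (ha : a = ν ∨ a = 1)
    (hV : ∀ ω, V ω = ν ∨ V ω = 1) (hW : ∀ ω, W ω = ν ∨ W ω = 1) (ω : ι ⊕ ι → Fin 2) :
    glueAtOrigin a V W ω = ν ∨ glueAtOrigin a V W ω = 1 := by
  unfold glueAtOrigin
  split_ifs
  · exact ha
  · exact hW _
  · exact hV _
  · exact Or.inr rfl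

theorem abs_expect_mul_dualFun_sub_one_le (hτ : 0 ≤ τ) (hτ1 : τ ≤ 1)
    (hν : cubeAvg (fun _ : ι ⊕ ι → Fin 2 => fun x => ν x - 1) ≤ τ ^ 2 ^ Fintype.card (ι ⊕ ι))
    {a : Z → ℝ} {V W : (ι → Fin 2) → Z → ℝ} (ha : a = ν ∨ a = 1)
    (hV : ∀ ω, V ω = ν ∨ V ω = 1) (hW : ∀ ω, W ω = ν ∨ W ω = 1) :
    |(𝔼 x, a x * (dualFun V x * dualFun W x)) - 1| ≤ 2 ^ 2 ^ Fintype.card (ι ⊕ ι) * τ := by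
  rw [← cubeAvg_glueAtOrigin]
  exact abs_cubeAvg_sub_one_le hτ hτ1 hν (glueAtOrigin_eq_or ha hV hW)

theorem abs_expect_sub_one_mul_dualFun_le (hτ : 0 ≤ τ) (hτ1 : τ ≤ 1)
    (hν : cubeAvg (fun _ : ι ⊕ ι → Fin 2 => fun x => ν x - 1) ≤ τ ^ 2 ^ Fintype.card (ι ⊕ ι))
    {F G V W : (ι → Fin 2) → Z → ℝ}
    (hV : ∀ ω, V ω = ν ∨ V ω = 1) (hW : ∀ ω, W ω = ν ∨ W ω = 1)
    (hF : ∀ ω, ω ≠ 0 → ∀ x, |F ω x| ≤ V ω x) (hG : ∀ ω, ω ≠ 0 → ∀ x, |G ω x| ≤ W ω x) :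
    |𝔼 x, (ν x - 1) * (dualFun F x * dualFun G x)| ≤
      τ * (1 + 2 ^ 2 ^ Fintype.card (ι ⊕ ι)) := by
  rw [← cubeAvg_glueAtOrigin (fun x => ν x - 1)]
  refine abs_cubeAvg_le_of_sub_one_factor hτ hτ1 hν (glueAtOrigin_eq_or (Or.inr rfl) hV hW) 0
    (by simp [glueAtOrigin]) fun ω hω x => ?_
  unfold glueAtOrigin
  split_ifs with h1 h2 h2
  · refine absurd ?_ hω
    funext i
    rcases i with i | i
    · exact congrFun h1 i
    · exact congrFun h2 i
  · exact hG _ h2 x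
  · exact hF _ h1 x
  · simp

end Pseudorandom

/-! ### Densification: replacing unbounded factors by bounded ones. -/

section Densification

theorem expect_mul_sq_le_of_abs_le {α : Type*} [Fintype α] {f ν : α → ℝ} (D : α → ℝ)
    (hf : ∀ x, |f x| ≤ ν x) :
    (𝔼 x, f x * D x) ^ 2 ≤ (𝔼 x, ν x) * 𝔼 x, ν x * D x ^ 2 := by
  have hν : ∀ x, 0 ≤ ν x := fun x => (abs_nonneg _).trans (hf x)
  have h1 : |𝔼 x, f x * D x| ≤ 𝔼 x, √(ν x) * (√(ν x) * |D x|) := by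
    refine (Finset.abs_expect_le _ _).trans (Finset.expect_le_expect fun x _ => ?_)
    rw [abs_mul, ← mul_assoc, Real.mul_self_sqrt (hν x)]
    exact mul_le_mul_of_nonneg_right (hf x) (abs_nonneg _)
  have h2 := Finset.expect_mul_sq_le_sq_mul_sq Finset.univ
    (fun x => √(ν x)) (fun x => √(ν x) * |D x|)
  simp only [mul_pow, sq_abs, Real.sq_sqrt (hν _)] at h2
  rw [← sq_abs]
  exact (pow_le_pow_left₀ (abs_nonneg _) h1 2).trans h2

theorem expect_abs_sq_le {α : Type*} [Fintype α] [Nonempty α] (f : α → ℝ) :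
    (𝔼 x, |f x|) ^ 2 ≤ 𝔼 x, f x ^ 2 := by
  simpa using Finset.expect_mul_sq_le_sq_mul_sq Finset.univ (fun x => |f x|) (fun _ => (1 : ℝ))

/-- Truncation changes `d` only by the excess of `|d|` over 1, which the excess of `w` dominates. -/
theorem abs_sub_clip_le {d w : ℝ} (h : |d| ≤ w) : |d - max (-1) (min 1 d)| ≤ |w - 1| := by
  have := abs_le.1 h
  rcases le_total d 1 with h1 | h1
  · rcases le_total (-1) d with h2 | h2
    · simp [h1, h2]
    · rw [min_eq_right h1, max_eq_left h2, abs_of_nonpos (by linarith)]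
      exact le_trans (by linarith) (le_abs_self _)
  · rw [min_eq_left h1, max_eq_right (by norm_num), abs_of_nonneg (by linarith)]
    exact le_trans (by linarith) (le_abs_self _)

theorem abs_clip_le_one (d : ℝ) : |max (-1) (min 1 d)| ≤ 1 :=
  abs_le.2 ⟨le_max_left _ _, max_le (by norm_num) (min_le_left _ _)⟩

variable {ι : Type*} [Fintype ι] [DecidableEq ι] [Nonempty ι]

section OneStep

variable {Z : Type*} [AddCommGroup Z] [Fintype Z] {τ : ℝ} {ν : Z → ℝ}

/-- The dual function of a system of majorants is close to `1` in mean square. -/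
theorem expect_dualFun_sub_one_sq_le (hτ : 0 ≤ τ) (hτ1 : τ ≤ 1)
    (hν : cubeAvg (fun _ : ι ⊕ ι → Fin 2 => fun x => ν x - 1) ≤ τ ^ 2 ^ Fintype.card (ι ⊕ ι))
    {V : (ι → Fin 2) → Z → ℝ} (hV : ∀ ω, V ω = ν ∨ V ω = 1) :
    𝔼 x, (dualFun V x - 1) ^ 2 ≤ 3 * (2 ^ 2 ^ Fintype.card (ι ⊕ ι) * τ) := by
  have h1 := abs_expect_mul_dualFun_sub_one_le hτ hτ1 hν (a := 1) (Or.inr rfl) hV hV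
  have h2 := abs_expect_mul_dualFun_sub_one_le hτ hτ1 hν (a := 1) (W := fun _ => 1) (Or.inr rfl)
    hV (fun _ => Or.inr rfl)
  have h3 : dualFun (fun _ : ι → Fin 2 => (1 : Z → ℝ)) = 1 := dualFun_one
  rw [h3] at h2
  simp only [Pi.one_apply, one_mul, mul_one] at h1 h2
  have h4 : 𝔼 x, (dualFun V x - 1) ^ 2 =
      (𝔼 x, dualFun V x * dualFun V x) - 2 * (𝔼 x, dualFun V x) + 1 := by
    have : ∀ x, (dualFun V x - 1) ^ 2 = dualFun V x * dualFun V x - 2 * dualFun V x + 1 :=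
      fun x => by ring
    simp only [this]
    rw [Finset.expect_add_distrib, Finset.expect_sub_distrib, ← Finset.mul_expect]
    simp
  rw [h4]
  have := (abs_le.1 h1).2
  have := (abs_le.1 h2).1
  linarith

/-- Replacing one function of a system by a truncated dual function. -/
theorem cubeAvg_sq_le_of_majorant (hτ : 0 ≤ τ) (hτ1 : τ ≤ 1)
    (hν : cubeAvg (fun _ : ι ⊕ ι → Fin 2 => fun x => ν x - 1) ≤ τ ^ 2 ^ Fintype.card (ι ⊕ ι))
    {κ : ℝ} (hκ : 0 ≤ κ) (hκ1 : κ ≤ 1)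
    (hτκ : 3 * ((1 + 2 ^ 2 ^ Fintype.card (ι ⊕ ι)) * τ) ≤ κ ^ 2)
    {F V : (ι → Fin 2) → Z → ℝ} (hV : ∀ ω, V ω = ν ∨ V ω = 1) (h0 : V 0 = ν)
    (hF : ∀ ω x, |F ω x| ≤ V ω x)
    (hclip : |cubeAvg (Function.update F 0 fun x => max (-1) (min 1 (dualFun F x)))| ≤ κ) :
    cubeAvg F ^ 2 ≤ 8 * κ := by
  set A : ℝ := 2 ^ 2 ^ Fintype.card (ι ⊕ ι) with hA
  have hA0 : 0 ≤ A := by positivity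
  have hAτ : 0 ≤ A * τ := mul_nonneg hA0 hτ
  have hκκ : κ ^ 2 ≤ κ := by nlinarith
  have hEν : 𝔼 x, ν x ≤ 2 := by
    have h := abs_expect_mul_dualFun_sub_one_le hτ hτ1 hν (a := ν) (V := fun _ : ι → Fin 2 => 1)
      (W := fun _ => 1) (Or.inl rfl) (fun _ => Or.inr rfl) (fun _ => Or.inr rfl)
    have h3 : dualFun (fun _ : ι → Fin 2 => (1 : Z → ℝ)) = 1 := dualFun_one
    rw [h3] at h
    simp only [Pi.one_apply, mul_one] at h
    have := (abs_le.1 h).2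
    nlinarith
  have hEν0 : 0 ≤ 𝔼 x, ν x :=
    Finset.expect_nonneg fun x _ => by
      have := (abs_nonneg _).trans (hF 0 x); rwa [h0] at this
  set D := dualFun F with hD
  set W := dualFun V with hW
  set T : Z → ℝ := fun x => max (-1) (min 1 (D x)) with hT
  have hDW : ∀ x, |D x| ≤ W x := abs_dualFun_le fun ω _ => hF ω
  -- The dual function ignores the origin, so this average is the cube average with `T` placed
  -- there.
  have hTD : 𝔼 x, T x * D x ≤ κ := by
    have h : cubeAvg (Function.update F 0 T) = 𝔼 x, T x * D x := by
      rw [cubeAvg_eq_expect_mul_dualFun]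
      have : dualFun (Function.update F 0 T) = D :=
        dualFun_congr fun ω hω => Function.update_of_ne hω _ _
      rw [this]; simp
    rw [← h]
    exact (le_abs_self _).trans hclip
  have hW2 : 𝔼 x, (W x - 1) ^ 2 ≤ κ ^ 2 := by
    have := expect_dualFun_sub_one_sq_le hτ hτ1 hν hV
    nlinarith
  have hW1 : 𝔼 x, |W x - 1| ≤ κ :=
    (pow_le_pow_iff_left₀ (Finset.expect_nonneg fun _ _ => abs_nonneg _) hκ two_ne_zero).1
      ((expect_abs_sq_le _).trans hW2)
  have hD2 : 𝔼 x, D x ^ 2 ≤ 3 * κ := by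
    -- Split `D² = T D + (D - T) D` and bound the last term by `|W - 1| W`, writing `W = (W - 1) +
    -- 1`.
    have hpt : ∀ x, D x ^ 2 ≤ T x * D x + ((W x - 1) ^ 2 + |W x - 1|) := by
      intro x
      have h1 : |D x - T x| ≤ |W x - 1| := abs_sub_clip_le (hDW x)
      have h2 : (D x - T x) * D x ≤ |W x - 1| * W x := by
        refine (le_abs_self _).trans ?_
        rw [abs_mul]
        exact mul_le_mul h1 (hDW x) (abs_nonneg _) (abs_nonneg _)
      have h3 : |W x - 1| * (W x - 1) ≤ (W x - 1) ^ 2 := by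
        rw [← sq_abs (W x - 1), sq]
        exact mul_le_mul_of_nonneg_left (le_abs_self _) (abs_nonneg _)
      nlinarith
    have h := Finset.expect_le_expect (s := Finset.univ) fun x _ => hpt x
    rw [Finset.expect_add_distrib, Finset.expect_add_distrib] at h
    linarith
  -- The weight `ν` is exchanged for 1 by viewing `(ν - 1) D²` as a cube average of doubled
  -- dimension with `ν - 1` at the origin.
  have hνD : 𝔼 x, ν x * D x ^ 2 ≤ 4 * κ := by
    have h1 := abs_expect_sub_one_mul_dualFun_le hτ hτ1 hν hV hV
      (fun ω _ => hF ω) (fun ω _ => hF ω)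
    have h2 : 𝔼 x, ν x * D x ^ 2 = (𝔼 x, D x ^ 2) + 𝔼 x, (ν x - 1) * (D x * D x) := by
      rw [← Finset.expect_add_distrib]
      exact Finset.expect_congr rfl fun x _ => by ring
    rw [h2]
    have := (abs_le.1 h1).2
    nlinarith
  have h := expect_mul_sq_le_of_abs_le (ν := ν) D (fun x => h0 ▸ hF 0 x)
  rw [cubeAvg_eq_expect_mul_dualFun]
  refine h.trans ?_
  calc (𝔼 x, ν x) * 𝔼 x, ν x * D x ^ 2 ≤ (𝔼 x, ν x) * (4 * κ) :=
        mul_le_mul_of_nonneg_left hνD hEν0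
    _ ≤ 2 * (4 * κ) := mul_le_mul_of_nonneg_right hEν (by positivity)
    _ = 8 * κ := by ring

end OneStep

omit [Fintype ι] [DecidableEq ι] [Nonempty ι] in
theorem cube_add_self_cancel (ω τ : ι → Fin 2) : ω + τ + τ = ω := by
  funext i
  have : ∀ a b : Fin 2, a + b + b = a := by decide
  exact this _ _

universe u

variable (ι) in
/-- If one function of a system is nearly orthogonal to all dual functions of bounded systems, then
the cube average of the system is small, even if some of its functions are only bounded by a
pseudorandom majorant. -/
theorem exists_forall_abs_cubeAvg_le (n : ℕ) : ∀ ε : ℝ, 0 < ε → ∃ δ : ℝ, 0 < δ ∧ δ ≤ 1 ∧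
    ∀ (Z : Type u) [AddCommGroup Z] [Fintype Z] (ν g : Z → ℝ),
      cubeAvg (fun _ : ι ⊕ ι → Fin 2 => fun x => ν x - 1) ≤ δ ^ 2 ^ Fintype.card (ι ⊕ ι) →
      (∀ x, |g x| ≤ ν x) →
      (∀ F : (ι → Fin 2) → Z → ℝ, (∀ ω x, |F ω x| ≤ 1) → |𝔼 x, g x * dualFun F x| ≤ δ) →
      ∀ (ω₀ : ι → Fin 2) (S : Finset (ι → Fin 2)) (F : (ι → Fin 2) → Z → ℝ), ω₀ ∉ S → S.card = n →
        F ω₀ = g → (∀ ω ∈ S, ∀ x, |F ω x| ≤ ν x) →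
        (∀ ω, ω ∉ S → ω ≠ ω₀ → ∀ x, |F ω x| ≤ 1) → |cubeAvg F| ≤ ε := by
  induction n with
  | zero =>
    intro ε hε
    refine ⟨min ε 1, lt_min hε one_pos, min_le_right _ _, ?_⟩
    intro Z _ _ ν g _ _ hweak ω₀ S F _ hS hg _ hF
    rw [Finset.card_eq_zero] at hS
    subst hS
    have hcancel : ∀ ω : ι → Fin 2, ω + ω₀ = ω₀ → ω = 0 := fun ω h => by simpa using h
    -- Base case: only the factor `g` is unbounded. It is moved to the origin, where the entry of
    -- the dual system is irrelevant and may be reset to 1.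
    rw [← cubeAvg_reflect ω₀, cubeAvg_eq_expect_mul_dualFun, zero_add, hg,
      dualFun_congr (G := Function.update (fun ω => F (ω + ω₀)) 0 1)
        (fun ω hω => (Function.update_of_ne hω _ (fun ω => F (ω + ω₀))).symm)]
    refine (hweak _ fun ω x => ?_).trans (min_le_left _ _)
    by_cases hω : ω = 0
    · subst hω; simp
    · rw [Function.update_of_ne hω]
      exact hF _ (by simp) (fun h => hω (hcancel ω h)) x
  | succ n ih =>
    intro ε hε
    -- The replacement step bounds the square by `8 * κ`, which must not exceed `ε ^ 2`.
    set κ : ℝ := min (ε ^ 2 / 8) 1 with hκ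
    have hκ0 : 0 < κ := lt_min (by positivity) one_pos
    obtain ⟨δ₁, hδ₁, hδ₁1, H⟩ := ih κ hκ0
    set A : ℝ := 2 ^ 2 ^ Fintype.card (ι ⊕ ι) with hA
    have hA0 : 0 < 3 * (1 + A) := by positivity
    set δ : ℝ := min δ₁ (κ ^ 2 / (3 * (1 + A))) with hδ
    have hδ0 : 0 < δ := lt_min hδ₁ (by positivity)
    have hδ1 : δ ≤ 1 := (min_le_left _ _).trans hδ₁1
    refine ⟨δ, hδ0, hδ1, ?_⟩
    intro Z _ _ ν g hν hgν hweak ω₀ S F hω₀ hS hg hFν hF1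
    obtain ⟨τ, hτS⟩ : S.Nonempty := Finset.card_pos.1 (by omega)
    set V : (ι → Fin 2) → Z → ℝ := fun ω => if ω ∈ insert ω₀ S then ν else 1 with hVdef
    have hV : ∀ ω, V ω = ν ∨ V ω = 1 := by
      intro ω
      simp only [hVdef]
      split_ifs
      exacts [Or.inl rfl, Or.inr rfl]
    have hFV : ∀ ω x, |F ω x| ≤ V ω x := by
      intro ω x
      simp only [hVdef]
      split_ifs with h
      · rcases Finset.mem_insert.1 h with h | h
        · rw [h, hg]; exact hgν x
        · exact hFν ω h x
      · rw [Finset.mem_insert, not_or] at h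
        exact hF1 ω h.2 h.1 x
    -- The unbounded factor at `τ ∈ S` goes to the origin to be replaced by its truncated dual
    -- function. The new system has unbounded vertices `S.erase τ`, translated by `τ`, besides `g`,
    -- so the induction hypothesis applies to it.
    rw [← cubeAvg_reflect τ]
    have hδκ : 3 * ((1 + A) * δ) ≤ κ ^ 2 := by
      have := (le_div_iff₀ hA0).1 (min_le_right δ₁ (κ ^ 2 / (3 * (1 + A))))
      linarith
    have hcancel : ∀ ω : ι → Fin 2, ω + τ = τ → ω = 0 := fun ω h => by simpa using h
    have hsq : cubeAvg (fun ω => F (ω + τ)) ^ 2 ≤ 8 * κ := by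
      refine cubeAvg_sq_le_of_majorant hδ0.le hδ1 hν hκ0.le (min_le_right _ _) hδκ
        (V := fun ω => V (ω + τ)) (fun ω => hV _) ?_ (fun ω => hFV _) ?_
      · simp [hVdef, hτS]
      · have hmem : ∀ ω, ω ∈ (S.erase τ).image (· + τ) ↔ ω + τ ∈ S.erase τ := by
          intro ω
          rw [Finset.mem_image]
          constructor
          · rintro ⟨θ, hθ, rfl⟩
            rwa [cube_add_self_cancel]
          · intro h
            exact ⟨ω + τ, h, cube_add_self_cancel _ _⟩
        have hne : ω₀ + τ ≠ 0 := by
          intro h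
          have h2 := cube_add_self_cancel ω₀ τ
          rw [h, zero_add] at h2
          exact hω₀ (h2 ▸ hτS)
        refine H Z ν g (hν.trans (pow_le_pow_left₀ hδ0.le (min_le_left _ _) _)) hgν
          (fun G hG => (hweak G hG).trans (min_le_left _ _)) (ω₀ + τ) ((S.erase τ).image (· + τ)) _
          ?_ ?_ ?_ ?_ ?_
        · rw [hmem, cube_add_self_cancel]
          exact fun h => hω₀ (Finset.mem_of_mem_erase h)
        · rw [Finset.card_image_of_injective _ (add_left_injective τ),
            Finset.card_erase_of_mem hτS, hS, Nat.add_sub_cancel]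
        · rw [Function.update_of_ne hne, cube_add_self_cancel, hg]
        · intro ω hω x
          have h := (hmem ω).1 hω
          have hω0 : ω ≠ 0 := by
            rintro rfl
            simp at h
          rw [Function.update_of_ne hω0]
          exact hFν _ (Finset.mem_of_mem_erase h) x
        · intro ω hω hωω x
          by_cases hω0 : ω = 0
          · subst hω0
            simpa using abs_clip_le_one _
          · rw [Function.update_of_ne hω0]
            refine hF1 _ (fun h => hω ((hmem ω).2 (Finset.mem_erase.2 ⟨?_, h⟩))) ?_ x
            · exact fun h => hω0 (hcancel ω h)
            · intro h
              exact hωω (by rw [← h, cube_add_self_cancel])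
    have h8 : 8 * κ ≤ ε ^ 2 := by
      have := min_le_left (ε ^ 2 / 8) 1
      linarith
    exact abs_le_of_sq_le_sq (hsq.trans h8) hε.le

end Densification

/-! ### The convex hull of dual functions is closed under multiplication. -/

section DualHull

variable {ι Z : Type*} [Fintype ι] [DecidableEq ι] [AddCommGroup Z] [Fintype Z]

variable (ι Z) in
/-- The closed convex hull of the dual functions of systems of functions bounded by `1`. -/
def dualHull : Set (Z → ℝ) :=
  closedConvexHull ℝ (dualFun '' {F : (ι → Fin 2) → Z → ℝ | ∀ ω x, |F ω x| ≤ 1})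

theorem convex_dualHull : Convex ℝ (dualHull ι Z) := convex_closedConvexHull

theorem isClosed_dualHull : IsClosed (dualHull ι Z) := isClosed_closedConvexHull

theorem dualFun_mem_dualHull {F : (ι → Fin 2) → Z → ℝ} (hF : ∀ ω x, |F ω x| ≤ 1) :
    dualFun F ∈ dualHull ι Z := subset_closedConvexHull ⟨F, hF, rfl⟩

theorem dualHull_subset {C : Set (Z → ℝ)} (hC : Convex ℝ C) (hC' : IsClosed C)
    (h : ∀ F : (ι → Fin 2) → Z → ℝ, (∀ ω x, |F ω x| ≤ 1) → dualFun F ∈ C) :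
    dualHull ι Z ⊆ C := by
  refine closedConvexHull_min ?_ hC hC'
  rintro _ ⟨F, hF, rfl⟩
  exact h F hF

theorem one_mem_dualHull : (1 : Z → ℝ) ∈ dualHull ι Z := by
  rw [← dualFun_one (ι := ι)]
  exact dualFun_mem_dualHull (by simp)

theorem dualHull_subset_box :
    dualHull ι Z ⊆ Set.univ.pi fun _ => Set.Icc (-1) 1 :=
  dualHull_subset (convex_pi fun _ _ => convex_Icc _ _)
    (isClosed_set_pi fun _ _ => isClosed_Icc)
    fun _ hF x _ => abs_le.1 (abs_dualFun_le_one hF x)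

theorem isCompact_dualHull : IsCompact (dualHull ι Z) :=
  (isCompact_univ_pi fun _ => isCompact_Icc).of_isClosed_subset isClosed_dualHull
    dualHull_subset_box

theorem abs_le_one_of_mem_dualHull {φ : Z → ℝ} (hφ : φ ∈ dualHull ι Z) (x : Z) : |φ x| ≤ 1 :=
  abs_le.2 (dualHull_subset_box hφ x (Set.mem_univ x))

/-- The sign is absorbed by the function at the vertex `1`, which differs from the origin. -/
theorem neg_mem_dualHull [Nonempty ι] {φ : Z → ℝ} (hφ : φ ∈ dualHull ι Z) :
    -φ ∈ dualHull ι Z := by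
  have h : dualHull ι Z ⊆ {ψ | -ψ ∈ dualHull ι Z} := by
    refine dualHull_subset (convex_dualHull.is_linear_preimage IsLinearMap.isLinearMap_neg)
      (isClosed_dualHull.preimage continuous_neg) fun F hF => ?_
    have h1 : (1 : ι → Fin 2) ≠ 0 := by
      intro h
      have := congrFun h (Classical.arbitrary ι)
      simp at this
    have h2 : -dualFun F = dualFun (Function.update F 1 (-F 1)) := by
      funext x
      simp only [Pi.neg_apply, dualFun, ← Finset.expect_neg_distrib]
      refine Finset.expect_congr rfl fun h _ => ?_
      have hmem : (1 : ι → Fin 2) ∈ Finset.univ.erase (0 : ι → Fin 2) := by simp [h1]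
      rw [← Finset.mul_prod_erase _ _ hmem, ← Finset.mul_prod_erase _ _ hmem, ← neg_mul]
      congr 1
      · simp
      · refine Finset.prod_congr rfl fun ω hω => ?_
        rw [Function.update_of_ne (Finset.ne_of_mem_erase hω)]
    change -dualFun F ∈ dualHull ι Z
    rw [h2]
    refine dualFun_mem_dualHull fun ω x => ?_
    by_cases hω : ω = 1
    · subst hω; simpa using hF 1 x
    · rw [Function.update_of_ne hω]; exact hF ω x
  exact h hφ

/-- Substituting `h + t` for the second set of directions, the product at each vertex `ω` is a
function of `x + ω · h` alone once `t` is fixed. The product of dual functions is therefore an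
average of dual functions over `t`, and bounds by 1 are preserved. -/
theorem dualFun_mul_dualFun (F G : (ι → Fin 2) → Z → ℝ) :
    dualFun F * dualFun G = ∑ t : ι → Z, ((Fintype.card (ι → Z) : ℝ)⁻¹) •
      dualFun (fun ω y => F ω y * G ω (y + ∑ i, (ω i : ℕ) • t i)) := by
  funext x
  have h1 : (dualFun F * dualFun G) x = 𝔼 t : ι → Z,
      dualFun (fun ω y => F ω y * G ω (y + ∑ i, (ω i : ℕ) • t i)) x := by
    simp only [Pi.mul_apply, dualFun]
    rw [Finset.expect_mul_expect, Finset.expect_comm]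
    conv_rhs => rw [Finset.expect_comm]
    conv_lhs => rw [Finset.expect_comm]
    refine Finset.expect_congr rfl fun h _ => ?_
    rw [← Fintype.expect_equiv (Equiv.addLeft h) (fun t => _ * _) _ (fun t => rfl)]
    refine Finset.expect_congr rfl fun t _ => ?_
    rw [← Finset.prod_mul_distrib]
    refine Finset.prod_congr rfl fun ω _ => ?_
    congr 2
    simp [add_assoc, Finset.sum_add_distrib]
  rw [h1, Fintype.expect_eq_sum_div_card, Finset.sum_apply, Finset.sum_div]
  refine Finset.sum_congr rfl fun t _ => ?_
  rw [Pi.smul_apply, smul_eq_mul, div_eq_inv_mul]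

/-- Multiplication is linear and continuous in each variable, so the case of generators extends to
the hull one factor at a time. -/
theorem mul_mem_dualHull {φ ψ : Z → ℝ} (hφ : φ ∈ dualHull ι Z) (hψ : ψ ∈ dualHull ι Z) :
    φ * ψ ∈ dualHull ι Z := by
  have hlin : ∀ χ : Z → ℝ, Convex ℝ {ρ : Z → ℝ | ρ * χ ∈ dualHull ι Z} := fun χ =>
    convex_dualHull.is_linear_preimage (f := fun ρ => ρ * χ)
      ⟨fun a b => add_mul a b χ, fun c a => smul_mul_assoc c a χ⟩
  have hclosed : ∀ χ : Z → ℝ, IsClosed {ρ : Z → ℝ | ρ * χ ∈ dualHull ι Z} := fun χ =>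
    isClosed_dualHull.preimage (continuous_mul_const χ)
  have h1 : ∀ F : (ι → Fin 2) → Z → ℝ, (∀ ω x, |F ω x| ≤ 1) →
      dualHull ι Z ⊆ {ρ | ρ * dualFun F ∈ dualHull ι Z} := by
    intro F hF
    refine dualHull_subset (hlin _) (hclosed _) fun G hG => ?_
    change dualFun G * dualFun F ∈ dualHull ι Z
    rw [dualFun_mul_dualFun]
    refine convex_dualHull.sum_mem (fun _ _ => by positivity) ?_ fun t _ => ?_
    · rw [Finset.sum_const, nsmul_eq_mul, Finset.card_univ]
      exact mul_inv_cancel₀ (by positivity)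
    · refine dualFun_mem_dualHull fun ω x => ?_
      rw [abs_mul]
      exact mul_le_one₀ (hG _ _) (abs_nonneg _) (hF _ _)
  have h2 : dualHull ι Z ⊆ {ρ | ρ * φ ∈ dualHull ι Z} := by
    refine dualHull_subset (hlin _) (hclosed _) fun G hG => ?_
    change dualFun G * φ ∈ dualHull ι Z
    rw [mul_comm]
    exact h1 G hG hφ
  rw [mul_comm]
  exact h2 hψ

theorem pow_mem_dualHull {φ : Z → ℝ} (hφ : φ ∈ dualHull ι Z) (n : ℕ) :
    φ ^ n ∈ dualHull ι Z := by
  induction n with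
  | zero => simpa using one_mem_dualHull
  | succ n ih => rw [pow_succ]; exact mul_mem_dualHull ih hφ

theorem abs_expect_mul_le_of_mem_dualHull {a φ : Z → ℝ} {c : ℝ}
    (h : ∀ F : (ι → Fin 2) → Z → ℝ, (∀ ω x, |F ω x| ≤ 1) → |𝔼 x, a x * dualFun F x| ≤ c)
    (hφ : φ ∈ dualHull ι Z) : |𝔼 x, a x * φ x| ≤ c := by
  have hsub : dualHull ι Z ⊆ {ψ | (𝔼 x, a x * ψ x) ∈ Set.Icc (-c) c} := by
    refine dualHull_subset ((convex_Icc (-c) c).is_linear_preimage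
      (f := fun ψ : Z → ℝ => 𝔼 x, a x * ψ x) ⟨fun u v => ?_, fun r u => ?_⟩)
      (isClosed_Icc.preimage ?_) fun F hF => abs_le.1 (h F hF)
    · simp only [Pi.add_apply, mul_add, Finset.expect_add_distrib]
    · simp only [Pi.smul_apply, smul_eq_mul, Finset.mul_expect]
      exact Finset.expect_congr rfl fun x _ => by ring
    · simp only [Fintype.expect_eq_sum_div_card]
      fun_prop
  exact abs_le.2 (hsub hφ)

end DualHull

/-! ### Separation by a minimax argument. -/

section Separation

theorem exists_le_forall_expect_sub_mul_le {Z : Type*} [Fintype Z] {f J : Z → ℝ} {K : Set (Z → ℝ)}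
    {δ : ℝ} (hJ : 0 ≤ J) (hK : Convex ℝ K) (hKc : IsCompact K) (hKn : K.Nonempty)
    (h : ∀ φ ∈ K, 𝔼 x, f x * φ x ≤ (𝔼 x, J x * max (φ x) 0) + δ) :
    ∃ g : Z → ℝ, 0 ≤ g ∧ g ≤ J ∧ ∀ φ ∈ K, 𝔼 x, (f x - g x) * φ x ≤ δ := by
  have hcont : Continuous fun p : (Z → ℝ) × (Z → ℝ) => 𝔼 x, (f x - p.1 x) * p.2 x := by
    simp only [Fintype.expect_eq_sum_div_card]
    fun_prop
  obtain ⟨g, hg, b, hb, hs⟩ := Sion.exists_isSaddlePointOn (X := Set.Icc (0 : Z → ℝ) J) (Y := K)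
    (f := fun g φ => 𝔼 x, (f x - g x) * φ x) ⟨0, le_rfl, hJ⟩ (convex_Icc _ _) isCompact_Icc
    (fun φ _ => (hcont.comp (by fun_prop : Continuous fun g : Z → ℝ =>
      (g, φ))).lowerSemicontinuous.lowerSemicontinuousOn _)
    (fun φ _ => by
      refine ConvexOn.quasiconvexOn ⟨convex_Icc _ _, fun u _ v _ r t _ _ hrt => le_of_eq ?_⟩
      simp only [Pi.add_apply, Pi.smul_apply, smul_eq_mul, Finset.mul_expect,
        ← Finset.expect_add_distrib]
      refine Finset.expect_congr rfl fun x _ => ?_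
      linear_combination (-(f x * φ x)) * hrt)
    hK hKn hKc
    (fun g _ => (hcont.comp (by fun_prop : Continuous fun φ : Z → ℝ =>
      (g, φ))).upperSemicontinuous.upperSemicontinuousOn _)
    (fun g _ => by
      refine ConcaveOn.quasiconcaveOn ⟨hK, fun u _ v _ r t _ _ hrt => le_of_eq ?_⟩
      simp only [Pi.add_apply, Pi.smul_apply, smul_eq_mul, Finset.mul_expect,
        ← Finset.expect_add_distrib]
      exact Finset.expect_congr rfl fun x _ => by ring)
  refine ⟨g, hg.1, hg.2, fun φ hφ => ?_⟩
  -- The saddle inequality is tested on the best response to `b`: full weight `J` where `b` is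
  -- positive, none elsewhere.
  have h1 := hs (fun x => if 0 < b x then J x else 0)
    ⟨fun x => by dsimp only; split_ifs; exacts [hJ x, le_rfl],
      fun x => by dsimp only; split_ifs; exacts [le_rfl, hJ x]⟩ φ hφ
  refine h1.trans ?_
  have h2 : 𝔼 x, (f x - if 0 < b x then J x else 0) * b x =
      (𝔼 x, f x * b x) - 𝔼 x, J x * max (b x) 0 := by
    rw [← Finset.expect_sub_distrib]
    refine Finset.expect_congr rfl fun x _ => ?_
    split_ifs with hx
    · rw [max_eq_left hx.le]; ring
    · rw [max_eq_right (not_lt.1 hx)]; ring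
  have := h b hb
  dsimp only
  linarith

end Separation

/-! ### The dense model theorem relative to dual functions. -/

section DenseModel

universe u

variable (ι : Type*) [Fintype ι] [DecidableEq ι] [Nonempty ι]

/-- A nonnegative function with a pseudorandom majorant is close to a bounded function when tested
against dual functions; the support of the bounded model is controlled by a function `J` that has
a good upper approximation by a multiple of a dual function. -/
theorem exists_dense_model {ε L : ℝ} (hε : 0 < ε) (hL : 0 ≤ L) : ∃ δ : ℝ, 0 < δ ∧ δ ≤ 1 ∧
    ∀ (Z : Type u) [AddCommGroup Z] [Fintype Z] (ν f J ψ : Z → ℝ) (c : ℝ), (∀ x, 0 ≤ ν x) →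
      cubeAvg (fun _ : ι ⊕ ι → Fin 2 => fun x => ν x - 1) ≤ δ ^ 2 ^ Fintype.card (ι ⊕ ι) →
      ψ ∈ dualHull ι Z → 0 ≤ c → c ≤ L → (∀ x, 0 ≤ J x) → (∀ x, J x ≤ c * ψ x) →
      (∀ x, c * ψ x ≤ 1) → 𝔼 x, (c * ψ x - J x) ≤ ε / 4 →
      (∀ x, 0 ≤ f x) → (∀ x, f x ≤ ν x * J x) →
      ∃ g : Z → ℝ, (∀ x, 0 ≤ g x) ∧ (∀ x, g x ≤ J x) ∧
        ∀ φ ∈ dualHull ι Z, |𝔼 x, (f x - g x) * φ x| ≤ ε := by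
  obtain ⟨p, hp⟩ := exists_polynomial_near_of_continuousOn (-1) 1 (fun x => max x 0)
    (by fun_prop) (ε / 12) (by positivity)
  set M : ℝ := ∑ i ∈ Finset.range (p.natDegree + 1), |p.coeff i| with hM
  have hM0 : 0 ≤ M := Finset.sum_nonneg fun _ _ => abs_nonneg _
  set A : ℝ := 1 + 2 ^ 2 ^ Fintype.card (ι ⊕ ι) with hA
  have hA0 : 0 < A := by positivity
  -- The bound `1 / A` keeps the mean of `ν + 1` below 3; the last term absorbs the coefficients of
  -- `p` and the factor `c ≤ L`.
  set δ : ℝ := min 1 (min (1 / A) (ε / 4 / (A * (L * M + 1)))) with hδ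
  have hδ0 : 0 < δ := by positivity
  have hδ1 : δ ≤ 1 := min_le_left _ _
  have hδA : δ * A ≤ 1 :=
    (le_div_iff₀ hA0).1 ((min_le_right _ _).trans (min_le_left _ _))
  have hδM : L * M * (δ * A) ≤ ε / 4 := by
    have h := (le_div_iff₀ (by positivity : 0 < A * (L * M + 1))).1
      ((min_le_right 1 _).trans (min_le_right (1 / A) (ε / 4 / (A * (L * M + 1)))))
    have h0 : 0 ≤ δ * A := by positivity
    nlinarith
  refine ⟨δ, hδ0, hδ1, ?_⟩
  intro Z _ _ ν f J ψ c hν0 hν hψ hc hcL hJ0 hJψ hψ1 hψJ hf0 hfν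
  have horth : ∀ φ ∈ dualHull ι Z, |𝔼 x, (ν x - 1) * φ x| ≤ δ * A := by
    intro φ hφ
    refine abs_expect_mul_le_of_mem_dualHull (fun F hF => ?_) hφ
    have h3 : dualFun (fun _ : ι → Fin 2 => (1 : Z → ℝ)) = 1 := dualFun_one
    have h := abs_expect_sub_one_mul_dualFun_le hδ0.le hδ1 hν (F := F) (G := fun _ => 1)
      (V := fun _ => 1) (W := fun _ => 1) (fun _ => Or.inr rfl) (fun _ => Or.inr rfl)
      (fun ω _ => hF ω) (by simp)
    simpa only [h3, Pi.one_apply, mul_one] using h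
  have hEν : 𝔼 x, (ν x + 1) ≤ 3 := by
    have h := (abs_le.1 ((horth 1 one_mem_dualHull).trans hδA)).2
    simp only [Pi.one_apply, mul_one] at h
    have h2 : 𝔼 x, (ν x + 1) = (𝔼 x, (ν x - 1)) + 2 := by
      have : ∀ x, ν x + 1 = (ν x - 1) + 2 := fun x => by ring
      simp only [this, Finset.expect_add_distrib]
      simp
    linarith
  have hψ0 : ∀ x, 0 ≤ c * ψ x := fun x => (hJ0 x).trans (hJψ x)
  have hmain : ∀ φ ∈ dualHull ι Z, 𝔼 x, f x * φ x ≤ (𝔼 x, J x * max (φ x) 0) + ε := by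
    intro φ hφ
    have hφ1 : ∀ x, |φ x| ≤ 1 := abs_le_one_of_mem_dualHull hφ
    -- Every monomial `ψ * φ ^ i` lies in the hull, so `ν - 1` is nearly orthogonal to it.
    have hpoly : |𝔼 x, (ν x - 1) * (c * ψ x * p.eval (φ x))| ≤ ε / 4 := by
      have h1 : 𝔼 x, (ν x - 1) * (c * ψ x * p.eval (φ x)) =
          ∑ i ∈ Finset.range (p.natDegree + 1), c * p.coeff i *
            𝔼 x, (ν x - 1) * (ψ * φ ^ i) x := by
        simp only [Finset.mul_expect]
        rw [← Finset.expect_sum_comm]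
        refine Finset.expect_congr rfl fun x _ => ?_
        rw [Polynomial.eval_eq_sum_range, Finset.mul_sum, Finset.mul_sum]
        refine Finset.sum_congr rfl fun i _ => ?_
        simp only [Pi.mul_apply, Pi.pow_apply]
        ring
      rw [h1]
      refine (Finset.abs_sum_le_sum_abs _ _).trans ?_
      calc _ ≤ ∑ i ∈ Finset.range (p.natDegree + 1), L * |p.coeff i| * (δ * A) := by
            refine Finset.sum_le_sum fun i _ => ?_
            rw [abs_mul, abs_mul, abs_of_nonneg hc]
            exact mul_le_mul (mul_le_mul_of_nonneg_right hcL (abs_nonneg _))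
              (horth _ (mul_mem_dualHull hψ (pow_mem_dualHull hφ i))) (abs_nonneg _)
              (by positivity)
        _ = L * M * (δ * A) := by rw [← Finset.sum_mul, ← Finset.mul_sum]
        _ ≤ _ := hδM
    -- Three errors, each of mean at most `ε / 4`: replacing `J` by `c * ψ`, the correlation of `ν -
    -- 1` with the polynomial, and the polynomial approximation.
    have hpt : ∀ x, f x * φ x ≤ J x * max (φ x) 0 + (c * ψ x - J x) +
        ((ν x - 1) * (c * ψ x * p.eval (φ x)) + ε / 12 * (ν x + 1)) := by
      intro x
      have hφx := abs_le.1 (hφ1 x)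
      set m := max (φ x) 0 with hm
      have hm0 : 0 ≤ m := le_max_right _ _
      have hm1 : m ≤ 1 := max_le hφx.2 zero_le_one
      have h1 : f x * φ x ≤ ν x * (c * ψ x) * m :=
        (mul_le_mul_of_nonneg_left (le_max_left _ _) (hf0 x)).trans
          (mul_le_mul_of_nonneg_right
            ((hfν x).trans (mul_le_mul_of_nonneg_left (hJψ x) (hν0 x))) hm0)
      have h2 : (c * ψ x - J x) * m ≤ c * ψ x - J x :=
        mul_le_of_le_one_right (sub_nonneg.2 (hJψ x)) hm1
      have h3 : (ν x - 1) * (c * ψ x) * (m - p.eval (φ x)) ≤ (ν x + 1) * 1 * (ε / 12) := by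
        refine (le_abs_self _).trans ?_
        rw [abs_mul, abs_mul]
        have h4 : |m - p.eval (φ x)| ≤ ε / 12 := by
          rw [abs_sub_comm]; exact (hp _ hφx).le
        have h5 : |ν x - 1| ≤ ν x + 1 := abs_le.2 ⟨by linarith [hν0 x], by linarith⟩
        have h6 : |c * ψ x| ≤ 1 := by rw [abs_of_nonneg (hψ0 x)]; exact hψ1 x
        have h7 : 0 ≤ ν x + 1 := by linarith [hν0 x]
        exact mul_le_mul (mul_le_mul h5 h6 (abs_nonneg _) h7) h4 (abs_nonneg _) (by linarith)
      nlinarith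
    have h := Finset.expect_le_expect (s := Finset.univ) fun x _ => hpt x
    simp only [Finset.expect_add_distrib (s := Finset.univ) (f := fun x => J x * max (φ x) 0 +
      (c * ψ x - J x)), Finset.expect_add_distrib (s := Finset.univ) (f := fun x =>
      J x * max (φ x) 0), Finset.expect_add_distrib (s := Finset.univ) (f := fun x =>
      (ν x - 1) * (c * ψ x * p.eval (φ x))), ← Finset.mul_expect] at h
    have h8 := (abs_le.1 hpoly).2
    have h9 : ε / 12 * 𝔼 x, (ν x + 1) ≤ ε / 12 * 3 :=
      mul_le_mul_of_nonneg_left hEν (by positivity)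
    linarith
  obtain ⟨g, hg0, hgJ, hg⟩ := exists_le_forall_expect_sub_mul_le (f := f) (J := J) hJ0
    convex_dualHull isCompact_dualHull ⟨1, one_mem_dualHull⟩ hmain
  refine ⟨g, hg0, hgJ, fun φ hφ => abs_le.2 ⟨?_, hg φ hφ⟩⟩
  have h := hg _ (neg_mem_dualHull hφ)
  simp only [Pi.neg_apply, mul_neg, Finset.expect_neg_distrib] at h
  linarith

end DenseModel

/-! ### A dual function constant on a prescribed set. -/

section Majorant

variable {ι Z : Type*} [Fintype ι] [DecidableEq ι] [AddCommGroup Z] [Fintype Z]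

theorem expect_pi_pair {i j : ι} (hij : i ≠ j) (G : Z → Z → ℝ) :
    𝔼 h : ι → Z, G (h i) (h j) = 𝔼 a, 𝔼 b, G a b := by
  have h1 : ∀ a b : Z, 𝔼 h : ι → Z, G (h i) (h j) = 𝔼 h : ι → Z, G (h i + a) (h j + b) := by
    intro a b
    refine (Fintype.expect_equiv
      (Equiv.addRight (Pi.single i a + Pi.single j b : ι → Z)) _ _ fun h => ?_).symm
    simp [hij, hij.symm]
  calc 𝔼 h : ι → Z, G (h i) (h j) = 𝔼 _a : Z, 𝔼 _b : Z, 𝔼 h : ι → Z, G (h i) (h j) := by simp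
    _ = 𝔼 a : Z, 𝔼 b : Z, 𝔼 h : ι → Z, G (h i + a) (h j + b) :=
        Finset.expect_congr rfl fun a _ => Finset.expect_congr rfl fun b _ => h1 a b
    _ = 𝔼 h : ι → Z, 𝔼 a : Z, 𝔼 b : Z, G (h i + a) (h j + b) := by
        rw [Finset.expect_comm]
        conv_rhs => rw [Finset.expect_comm]
        rw [Finset.expect_comm]
        exact Finset.expect_congr rfl fun a _ => Finset.expect_comm _ _ _
    _ = 𝔼 _h : ι → Z, 𝔼 a, 𝔼 b, G a b := by
        refine Finset.expect_congr rfl fun h _ => ?_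
        refine Fintype.expect_equiv (Equiv.addLeft (h i)) _ _ fun a => ?_
        exact Fintype.expect_equiv (Equiv.addLeft (h j)) _ _ fun b => rfl
    _ = _ := by simp

omit [AddCommGroup Z] in
theorem expect_boole_mem [DecidableEq Z] (A : Finset Z) :
    𝔼 x, (if x ∈ A then (1 : ℝ) else 0) = A.card / Fintype.card Z := by
  rw [Fintype.expect_eq_sum_div_card]
  simp

/-- The indicators of `A`, `A`, `B` are placed on the three other vertices of a parallelogram at
`x`. Then `ψ x` is the density of pairs `(a, b)` in `A × A` with `a + b - x ∈ B`: all of `A × A`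
counts when `x ∈ I`, and averaging over `x` yields the density of `B`. -/
theorem exists_mem_dualHull_majorant [DecidableEq Z] {i j : ι} (hij : i ≠ j) (A B I : Finset Z)
    (hB : ∀ a ∈ A, ∀ b ∈ A, ∀ x ∈ I, a + b - x ∈ B) :
    ∃ ψ ∈ dualHull ι Z, (∀ x, 0 ≤ ψ x) ∧
      (∀ x, ψ x ≤ ((A.card : ℝ) / Fintype.card Z) ^ 2) ∧
      (∀ x ∈ I, ψ x = ((A.card : ℝ) / Fintype.card Z) ^ 2) ∧
      𝔼 x, ψ x = ((A.card : ℝ) / Fintype.card Z) ^ 2 * ((B.card : ℝ) / Fintype.card Z) := by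
  set u : Z → ℝ := fun x => if x ∈ A then 1 else 0 with hu
  set v : Z → ℝ := fun x => if x ∈ B then 1 else 0 with hv
  have hu0 : ∀ x, 0 ≤ u x := fun x => by simp only [hu]; split_ifs <;> norm_num
  have hu1 : ∀ x, u x ≤ 1 := fun x => by simp only [hu]; split_ifs <;> norm_num
  have hv0 : ∀ x, 0 ≤ v x := fun x => by simp only [hv]; split_ifs <;> norm_num
  have hv1 : ∀ x, v x ≤ 1 := fun x => by simp only [hv]; split_ifs <;> norm_num
  set ei : ι → Fin 2 := Pi.single i 1 with hei
  set ej : ι → Fin 2 := Pi.single j 1 with hej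
  have hijne : ei ≠ ej := by
    intro h
    have := congrFun h i
    simp [hei, hej, hij] at this
  have hi2 : ei + ej ≠ ei := by
    intro h
    have := congrFun h j
    simp [hei, hej, hij.symm] at this
  have hj2 : ei + ej ≠ ej := by
    intro h
    have := congrFun h i
    simp [hei, hej, hij] at this
  have hi0 : ei ≠ 0 := by
    intro h
    have := congrFun h i
    simp [hei] at this
  have hj0 : ej ≠ 0 := by
    intro h
    have := congrFun h j
    simp [hej] at this
  have hij0 : ei + ej ≠ 0 := by
    intro h
    have := congrFun h i
    simp [hei, hej, hij] at this
  set F : (ι → Fin 2) → Z → ℝ := fun ω =>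
    if ω = ei then u else if ω = ej then u else if ω = ei + ej then v else 1 with hF
  have hFle : ∀ ω x, |F ω x| ≤ 1 := by
    intro ω x
    simp only [hF]
    split_ifs
    · rw [abs_of_nonneg (hu0 x)]; exact hu1 x
    · rw [abs_of_nonneg (hu0 x)]; exact hu1 x
    · rw [abs_of_nonneg (hv0 x)]; exact hv1 x
    · simp
  have hsi : ∀ h : ι → Z, ∑ k, (ei k : ℕ) • h k = h i := by
    intro h
    rw [Finset.sum_eq_single i (fun k _ hk => by simp [hei, hk]) (by simp)]
    simp [hei]
  have hsj : ∀ h : ι → Z, ∑ k, (ej k : ℕ) • h k = h j := by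
    intro h
    rw [Finset.sum_eq_single j (fun k _ hk => by simp [hej, hk]) (by simp)]
    simp [hej]
  have hsij : ∀ h : ι → Z, ∑ k, ((ei + ej) k : ℕ) • h k = h i + h j := by
    intro h
    rw [← hsi h, ← hsj h, ← Finset.sum_add_distrib]
    refine Finset.sum_congr rfl fun k _ => ?_
    by_cases hki : k = i
    · subst hki; simp [hei, hej, hij]
    · by_cases hkj : k = j
      · subst hkj; simp [hei, hej, hij.symm]
      · simp [hei, hej, hki, hkj]
  have hdual : ∀ x, dualFun F x = 𝔼 a, 𝔼 b, u a * (u b * v (a + b - x)) := by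
    intro x
    have h1 : dualFun F x = 𝔼 h : ι → Z, u (x + h i) * (u (x + h j) * v (x + (h i + h j))) := by
      unfold dualFun
      refine Finset.expect_congr rfl fun h _ => ?_
      rw [← Finset.prod_subset (s₁ := {ei, ej, ei + ej})]
      · rw [Finset.prod_insert (by simp [hijne, hi2.symm, -left_eq_add, -add_eq_left]),
          Finset.prod_insert (by simpa using hj2.symm), Finset.prod_singleton, hsi, hsj, hsij]
        simp only [hF, if_true, if_neg hijne.symm, if_neg hi2, if_neg hj2]
      · intro ω hω
        simp only [Finset.mem_insert, Finset.mem_singleton] at hω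
        refine Finset.mem_erase.2 ⟨?_, Finset.mem_univ _⟩
        rcases hω with rfl | rfl | rfl
        exacts [hi0, hj0, hij0]
      · intro ω _ hω
        simp only [Finset.mem_insert, Finset.mem_singleton, not_or] at hω
        simp [hF, hω]
    rw [h1, expect_pi_pair hij (fun a b => u (x + a) * (u (x + b) * v (x + (a + b))))]
    refine Fintype.expect_equiv (Equiv.addLeft x) _ _ fun a => ?_
    refine Fintype.expect_equiv (Equiv.addLeft x) _ _ fun b => ?_
    simp only [Equiv.coe_addLeft]
    congr 3
    abel
  have hEu : 𝔼 x, u x = (A.card : ℝ) / Fintype.card Z := expect_boole_mem A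
  have hEv : 𝔼 x, v x = (B.card : ℝ) / Fintype.card Z := expect_boole_mem B
  have hsq : ((A.card : ℝ) / Fintype.card Z) ^ 2 = 𝔼 a, 𝔼 b, u a * u b := by
    rw [sq, ← hEu, Finset.expect_mul_expect]
  refine ⟨dualFun F, dualFun_mem_dualHull hFle, fun x => ?_, fun x => ?_, fun x hx => ?_, ?_⟩
  · rw [hdual]
    exact Finset.expect_nonneg fun a _ => Finset.expect_nonneg fun b _ =>
      mul_nonneg (hu0 a) (mul_nonneg (hu0 b) (hv0 _))
  · rw [hdual, hsq]
    refine Finset.expect_le_expect fun a _ => Finset.expect_le_expect fun b _ => ?_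
    exact mul_le_mul_of_nonneg_left (mul_le_of_le_one_right (hu0 b) (hv1 _)) (hu0 a)
  · rw [hdual, hsq]
    refine Finset.expect_congr rfl fun a _ => Finset.expect_congr rfl fun b _ => ?_
    by_cases ha : a ∈ A
    · by_cases hb : b ∈ A
      · simp [hu, hv, ha, hb, hB a ha b hb x hx]
      · simp [hu, hb]
    · simp [hu, ha]
  · simp only [hdual]
    rw [Finset.expect_comm, hsq, Finset.expect_mul]
    refine Finset.expect_congr rfl fun a _ => ?_
    rw [Finset.expect_comm, Finset.expect_mul]
    refine Finset.expect_congr rfl fun b _ => ?_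
    simp only [← mul_assoc, ← Finset.mul_expect]
    rw [← hEv]
    congr 1
    exact Fintype.expect_equiv (Equiv.subLeft (a + b)) _ _ fun x => rfl

end Majorant

/-! ### Gowers norms on intervals and independence of the modulus. -/

section IntervalNorm

variable {N : ℕ}

/-- The extension by zero of a function on `{1, …, N}` to the integers. -/
def extendInt (f : Finset.Icc 1 N → ℝ) (z : ℤ) : ℝ :=
  if hz : z.toNat ∈ Finset.Icc 1 N then f ⟨z.toNat, hz⟩ else 0

theorem val_intCast_of_mem {M : ℕ} [NeZero M] (hM : 2 * N < M) {z : ℤ} (h1 : 1 ≤ z) (h2 : z ≤ N) :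
    (z : ZMod M).val = z.toNat := by
  obtain ⟨n, rfl⟩ := Int.eq_ofNat_of_zero_le (zero_le_one.trans h1)
  simp only [Int.cast_natCast, Int.toNat_natCast]
  exact ZMod.val_natCast_of_lt (by simp at h2; omega)

theorem mem_of_val_intCast_mem {M : ℕ} [NeZero M] (hM : 2 * N < M) {z : ℤ} (h1 : -N < z)
    (h2 : z ≤ 2 * N) (h : (z : ZMod M).val ∈ Finset.Icc 1 N) : 1 ≤ z ∧ z ≤ N := by
  rw [Finset.mem_Icc] at h
  have h3 : ((z : ℤ) : ZMod M) = (((z : ZMod M).val : ℤ) : ZMod M) := by simp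
  rw [ZMod.intCast_eq_intCast_iff_dvd_sub] at h3
  have h4 := Int.eq_zero_of_abs_lt_dvd h3 (abs_lt.2 ⟨by omega, by omega⟩)
  omega

/-- A parallelepiped modulo `M` with all vertices in `[N]` lifts to exactly one integer
parallelepiped in `[N]`, so the sum does not depend on `M`. -/
theorem sum_cube_extendInterval {M : ℕ} [NeZero M] (hM : 2 * N < M) (s : ℕ)
    (f : Finset.Icc 1 N → ℝ) :
    ∑ p : ZMod M × (Fin s → ZMod M),
        ∏ ω : Fin s → Fin 2, extendInterval M f (p.1 + ∑ i, (ω i : ℕ) • p.2 i) =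
      ∑ p ∈ Finset.Icc (1 : ℤ) N ×ˢ Fintype.piFinset (fun _ : Fin s => Finset.Icc (-N : ℤ) N),
        ∏ ω : Fin s → Fin 2, extendInt f (p.1 + ∑ i, (ω i : ℕ) • p.2 i) := by
  symm
  have hinj : ∀ a b : ℤ, -N ≤ a → a ≤ N → -N ≤ b → b ≤ N → (a : ZMod M) = b → a = b := by
    intro a b ha ha' hb hb' h
    rw [ZMod.intCast_eq_intCast_iff_dvd_sub] at h
    have := Int.eq_zero_of_abs_lt_dvd h (abs_lt.2 ⟨by omega, by omega⟩)
    omega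
  refine Finset.sum_of_injOn (fun p => ((p.1 : ZMod M), fun i => (p.2 i : ZMod M))) ?_
    (fun _ _ => Finset.mem_coe.2 (Finset.mem_univ _)) ?_ ?_
  · rintro ⟨x, h⟩ hp ⟨y, k⟩ hq heq
    simp only [Finset.coe_product, Set.mem_prod, Finset.mem_coe, Finset.mem_Icc,
      Fintype.mem_piFinset] at hp hq
    simp only [Prod.mk.injEq] at heq
    refine Prod.ext (hinj _ _ (by omega) hp.1.2 (by omega) hq.1.2 heq.1) (funext fun i => ?_)
    exact hinj _ _ (hp.2 i).1 (hp.2 i).2 (hq.2 i).1 (hq.2 i).2 (congrFun heq.2 i)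
  · rintro ⟨x, h⟩ _ hnot
    by_contra hne
    have hmem : ∀ ω : Fin s → Fin 2,
        (x + ∑ i, (ω i : ℕ) • h i).val ∈ Finset.Icc 1 N := by
      intro ω
      by_contra hω
      exact hne (Finset.prod_eq_zero (Finset.mem_univ ω) (by simp only [extendInterval, dif_neg hω]))
    have hx := hmem 0
    simp only [Pi.zero_apply, Fin.val_zero, zero_smul, Finset.sum_const_zero, add_zero,
      Finset.mem_Icc] at hx
    have hxi : ∀ i, (x + h i).val ∈ Finset.Icc 1 N := by
      intro i
      have := hmem (Pi.single i 1)
      rw [Finset.sum_eq_single i (fun k _ hk => by simp [hk]) (by simp)] at this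
      simpa using this
    simp only [Finset.mem_Icc] at hxi
    refine hnot ⟨((x.val : ℤ), fun i => ((x + h i).val : ℤ) - x.val), ?_, ?_⟩
    · simp only [Finset.coe_product, Set.mem_prod, Finset.mem_coe, Finset.mem_Icc,
        Fintype.mem_piFinset]
      refine ⟨by omega, fun i => ?_⟩
      have := hxi i
      omega
    · refine Prod.ext (by simp) (funext fun i => by simp)
  · rintro ⟨x, h⟩ hp
    simp only [Finset.mem_product, Finset.mem_Icc, Fintype.mem_piFinset] at hp
    have hcast : ∀ ω : Fin s → Fin 2, (x : ZMod M) + ∑ i, (ω i : ℕ) • (h i : ZMod M) =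
        ((x + ∑ i, (ω i : ℕ) • h i : ℤ) : ZMod M) := by
      intro ω; simp only [nsmul_eq_mul]; push_cast; rfl
    simp only [hcast]
    by_cases H : ∀ ω : Fin s → Fin 2,
        ((x + ∑ i, (ω i : ℕ) • h i : ℤ) : ZMod M).val ∈ Finset.Icc 1 N
    · refine Finset.prod_congr rfl fun ω _ => ?_
      -- Directions are added one at a time. A step of size at most `N` from `[1, N]` stays in `(-N,
      -- 2N]`, where a residue in `[N]` forces the integer itself into `[N]`.
      have hS : ∀ S : Finset (Fin s), 1 ≤ x + ∑ i ∈ S, (ω i : ℕ) • h i ∧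
          x + ∑ i ∈ S, (ω i : ℕ) • h i ≤ N := by
        intro S
        induction S using Finset.induction_on with
        | empty => simpa using hp.1
        | insert j S hj ih =>
          have hmem := H (fun i => if i ∈ insert j S then ω i else 0)
          have hsum : ∑ i, (((if i ∈ insert j S then ω i else 0 : Fin 2)) : ℕ) • h i =
              ∑ i ∈ insert j S, (ω i : ℕ) • h i := by
            rw [← Finset.sum_subset (Finset.subset_univ (insert j S))
              (fun i _ hi => by simp only [if_neg hi, Fin.val_zero, zero_smul])]
            exact Finset.sum_congr rfl fun i hi => by simp only [if_pos hi]
          rw [hsum] at hmem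
          have hj2 := hp.2 j
          have hb : -(N : ℤ) ≤ (ω j : ℕ) • h j ∧ (ω j : ℕ) • h j ≤ N := by
            have h2 : ∀ a : Fin 2, a = 0 ∨ a = 1 := by decide
            rcases h2 (ω j) with ha | ha <;> simp [ha, hj2]
          have heq := Finset.sum_insert (f := fun i => (ω i : ℕ) • h i) hj
          exact mem_of_val_intCast_mem hM (by omega) (by omega) hmem
      have hz := hS Finset.univ
      simp only [extendInterval, extendInt, val_intCast_of_mem hM hz.1 hz.2]
    · push Not at H
      obtain ⟨ω, hω⟩ := H
      rw [Finset.prod_eq_zero (Finset.mem_univ ω), Finset.prod_eq_zero (Finset.mem_univ ω)]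
      · simp only [extendInterval, dif_neg hω]
      · refine dif_neg fun hz => hω ?_
        have hz' := Finset.mem_Icc.1 hz
        rw [val_intCast_of_mem hM (by omega) (by omega)]
        exact hz

theorem gowersIntervalNorm_eq_of_lt {M M' : ℕ} [NeZero M] [NeZero M'] (hM : 2 * N < M)
    (hM' : 2 * N < M') {s : ℕ} (hs : s ≠ 0) (f : Finset.Icc 1 N → ℝ) :
    gowersIntervalNorm M s f = gowersIntervalNorm M' s f := by
  have : Nonempty (Fin s) := ⟨⟨0, Nat.pos_of_ne_zero hs⟩⟩
  have key : ∀ (K : ℕ) [NeZero K], 2 * N < K → gowersIntervalNorm K s f =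
      ((∑ p ∈ Finset.Icc (1 : ℤ) N ×ˢ Fintype.piFinset (fun _ : Fin s => Finset.Icc (-N : ℤ) N),
        ∏ ω : Fin s → Fin 2, extendInt f (p.1 + ∑ i, (ω i : ℕ) • p.2 i)) /
      ∑ p ∈ Finset.Icc (1 : ℤ) N ×ˢ Fintype.piFinset (fun _ : Fin s => Finset.Icc (-N : ℤ) N),
        ∏ ω : Fin s → Fin 2, extendInt (fun _ : Finset.Icc 1 N => (1 : ℝ))
          (p.1 + ∑ i, (ω i : ℕ) • p.2 i)) ^ (1 / (2 : ℝ) ^ s) := by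
    intro K _ hK
    have hcard : (Fintype.card (ZMod K × (Fin s → ZMod K)) : ℝ) ≠ 0 := by positivity
    unfold gowersIntervalNorm
    rw [gowersNorm_eq_cubeAvg, gowersNorm_eq_cubeAvg,
      ← Real.div_rpow (cubeAvg_const_nonneg _) (cubeAvg_const_nonneg _)]
    unfold cubeAvg
    rw [Fintype.expect_eq_sum_div_card, Fintype.expect_eq_sum_div_card,
      sum_cube_extendInterval hK, sum_cube_extendInterval hK, div_div_div_cancel_right₀ hcard]
  rw [key M hM, key M' hM']

theorem extendInterval_sub (M : ℕ) (f g : Finset.Icc 1 N → ℝ) (x : ZMod M) :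
    extendInterval M (fun n => f n - g n) x = extendInterval M f x - extendInterval M g x := by
  unfold extendInterval
  split_ifs <;> simp

/-- The interval `{1, …, N}` as a subset of `ℤ/Mℤ`. -/
def intervalFinset (N M : ℕ) : Finset (ZMod M) :=
  (Finset.Icc 1 N).image (Nat.cast : ℕ → ZMod M)

theorem mem_intervalFinset {M : ℕ} [NeZero M] (hM : N < M) {x : ZMod M} :
    x ∈ intervalFinset N M ↔ x.val ∈ Finset.Icc 1 N := by
  unfold intervalFinset
  rw [Finset.mem_image]
  constructor
  · rintro ⟨n, hn, rfl⟩
    rwa [ZMod.val_natCast_of_lt (by rw [Finset.mem_Icc] at hn; omega)]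
  · intro h
    exact ⟨x.val, h, by simp⟩

theorem card_image_natCast {M : ℕ} {s : Finset ℕ} (h : ∀ n ∈ s, n < M) :
    (s.image (Nat.cast : ℕ → ZMod M)).card = s.card := by
  refine Finset.card_image_of_injOn fun a ha b hb hab => ?_
  have hab' : (a : ZMod M) = b := hab
  rw [ZMod.natCast_eq_natCast_iff'] at hab'
  rwa [Nat.mod_eq_of_lt (h a ha), Nat.mod_eq_of_lt (h b hb)] at hab'

theorem card_intervalFinset {M : ℕ} (hM : N < M) : (intervalFinset N M).card = N := by
  unfold intervalFinset
  rw [card_image_natCast fun n hn => by rw [Finset.mem_Icc] at hn; omega]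
  simp

theorem extendInterval_one {M : ℕ} [NeZero M] (hM : N < M) :
    extendInterval M (fun _ : Finset.Icc 1 N => (1 : ℝ)) =
      fun x => if x ∈ intervalFinset N M then 1 else 0 := by
  funext x
  simp only [mem_intervalFinset hM]
  unfold extendInterval
  split_ifs <;> rfl

theorem pow_expect_le_cubeAvg {ι Z : Type*} [Fintype ι] [DecidableEq ι] [Nonempty ι]
    [AddCommGroup Z] [Fintype Z] (f : Z → ℝ) :
    |𝔼 x, f x| ^ 2 ^ Fintype.card ι ≤ cubeAvg (fun _ : ι → Fin 2 => f) := by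
  have h := abs_cubeAvg_pow_le (Function.update (fun _ : ι → Fin 2 => (fun _ : Z => (1 : ℝ))) 0 f)
  rw [cubeAvg_eq_expect_mul_dualFun, dualFun_congr (G := fun _ => fun _ => 1)
    (fun ω hω => Function.update_of_ne hω _ _), dualFun_one,
    ← Finset.mul_prod_erase _ _ (Finset.mem_univ (0 : ι → Fin 2)),
    Finset.prod_eq_one fun ω hω => by
      rw [Function.update_of_ne (Finset.ne_of_mem_erase hω), cubeAvg_one]] at h
  simpa using h

/-- The normalising norm is at least the mean `N / M ≥ 1 / D` of the indicator. -/
theorem gowersIntervalNorm_le {M s : ℕ} [NeZero M] (hs : s ≠ 0) (hN : 0 < N) (hM : N < M)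
    {ε D : ℝ} (hε : 0 ≤ ε) (hD : 0 < D) (hMD : (M : ℝ) ≤ D * N) (f : Finset.Icc 1 N → ℝ)
    (hf : cubeAvg (fun _ : Fin s → Fin 2 => extendInterval M f) ≤ (ε / D) ^ 2 ^ s) :
    gowersIntervalNorm M s f ≤ ε := by
  have : Nonempty (Fin s) := ⟨⟨0, Nat.pos_of_ne_zero hs⟩⟩
  have hM0 : (0 : ℝ) < M := by exact_mod_cast hN.trans hM
  have hone : (1 / D) ^ 2 ^ s ≤
      cubeAvg (fun _ : Fin s → Fin 2 => extendInterval M (fun _ : Finset.Icc 1 N => (1 : ℝ))) := by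
    have h := pow_expect_le_cubeAvg (ι := Fin s)
      (extendInterval M (fun _ : Finset.Icc 1 N => (1 : ℝ)))
    rw [Fintype.card_fin] at h
    refine le_trans (pow_le_pow_left₀ (by positivity) ?_ _) h
    rw [extendInterval_one hM, expect_boole_mem, card_intervalFinset hM, ZMod.card,
      abs_of_nonneg (by positivity), div_le_div_iff₀ hD hM0]
    linarith
  have hpos : 0 < cubeAvg
      (fun _ : Fin s → Fin 2 => extendInterval M (fun _ : Finset.Icc 1 N => (1 : ℝ))) :=
    lt_of_lt_of_le (by positivity) hone
  unfold gowersIntervalNorm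
  rw [gowersNorm_eq_cubeAvg, gowersNorm_eq_cubeAvg,
    ← Real.div_rpow (cubeAvg_const_nonneg _) hpos.le]
  have hle : cubeAvg (fun _ : Fin s → Fin 2 => extendInterval M f) / cubeAvg
      (fun _ : Fin s → Fin 2 => extendInterval M (fun _ : Finset.Icc 1 N => (1 : ℝ))) ≤
      ε ^ 2 ^ s := by
    rw [div_le_iff₀ hpos]
    refine hf.trans ?_
    rw [div_eq_mul_one_div, mul_pow]
    exact mul_le_mul_of_nonneg_left hone (by positivity)
  refine (Real.rpow_le_rpow (div_nonneg (cubeAvg_const_nonneg _) hpos.le) hle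
    (by positivity)).trans (le_of_eq ?_)
  have := Real.pow_rpow_inv_natCast hε (pow_ne_zero s two_ne_zero : 2 ^ s ≠ 0)
  rw [one_div]
  exact_mod_cast this

end IntervalNorm

/-! ### Transference to the interval and the final argument. -/

section Transference

theorem cubeAvg_const_mul {ι Z : Type*} [Fintype ι] [DecidableEq ι] [AddCommGroup Z] [Fintype Z]
    (c : ℝ) (f : Z → ℝ) : cubeAvg (fun _ : ι → Fin 2 => fun x => c * f x) =
      c ^ 2 ^ Fintype.card ι * cubeAvg (fun _ : ι → Fin 2 => f) := by
  unfold cubeAvg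
  rw [Finset.mul_expect]
  refine Finset.expect_congr rfl fun p _ => ?_
  rw [Finset.prod_mul_distrib]
  simp

/-- The indicator function of `{1, …, N}` in `ℤ/Mℤ` has a good upper approximation by a bounded
multiple of a dual function. -/
theorem exists_interval_majorant {ι : Type*} [Fintype ι] [DecidableEq ι] {i j : ι} (hij : i ≠ j)
    {δ : ℝ} (hδ : 0 < δ) (hδ1 : δ ≤ 1) {N M : ℕ} [NeZero M] (hNM : N < M) (hM : 1 / δ ≤ M) :
    ∃ ψ ∈ dualHull ι (ZMod M), ∃ c : ℝ, 0 ≤ c ∧ c ≤ 1 / δ ^ 2 ∧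
      (∀ x, (if x ∈ intervalFinset N M then 1 else 0) ≤ c * ψ x) ∧ (∀ x, c * ψ x ≤ 1) ∧
      𝔼 x, (c * ψ x - if x ∈ intervalFinset N M then 1 else 0) ≤ 4 * δ := by
  have hM0 : (0 : ℝ) < M := by exact_mod_cast NeZero.pos M
  set m : ℕ := ⌈δ * M⌉₊ with hm
  have hm0 : δ * M ≤ m := Nat.le_ceil _
  have hm1 : (m : ℝ) < δ * M + 1 := Nat.ceil_lt_add_one (by positivity)
  have hmM : m ≤ M := by
    rw [hm, Nat.ceil_le]
    exact mul_le_of_le_one_left hM0.le hδ1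
  have hδM : 1 ≤ δ * M := by
    rw [div_le_iff₀ hδ] at hM
    linarith
  set A : Finset (ZMod M) := (Finset.range m).image Nat.cast with hA
  have hAcard : A.card = m := by
    rw [hA, card_image_natCast fun n hn => (Finset.mem_range.1 hn).trans_le hmM]
    simp
  -- `B` contains `A + A - [N]` and exceeds `[N]` by at most `2 * m` elements. As `m < δ * M + 1 ≤ 2
  -- * δ * M`, the mean error is at most `4 * δ`.
  set B : Finset (ZMod M) := (Finset.Ico (-N : ℤ) (2 * m)).image Int.cast with hB
  have hBcard : (B.card : ℝ) ≤ N + 2 * m := by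
    have h : B.card ≤ N + 2 * m := by
      refine Finset.card_image_le.trans ?_
      rw [Int.card_Ico]
      omega
    exact_mod_cast h
  have hAB : ∀ a ∈ A, ∀ b ∈ A, ∀ x ∈ intervalFinset N M, a + b - x ∈ B := by
    intro a ha b hb x hx
    obtain ⟨k, hk, rfl⟩ := Finset.mem_image.1 ha
    obtain ⟨l, hl, rfl⟩ := Finset.mem_image.1 hb
    obtain ⟨n, hn, rfl⟩ := Finset.mem_image.1 hx
    rw [Finset.mem_range] at hk hl
    rw [Finset.mem_Icc] at hn
    refine Finset.mem_image.2 ⟨(k : ℤ) + l - n, Finset.mem_Ico.2 ⟨by omega, by omega⟩, ?_⟩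
    push_cast
    rfl
  obtain ⟨ψ, hψ, hψ0, hψle, hψeq, hψE⟩ := exists_mem_dualHull_majorant hij A B _ hAB
  rw [hAcard, ZMod.card] at hψle hψeq hψE
  set κ : ℝ := (m : ℝ) / M with hκ
  have hκδ : δ ≤ κ := (le_div_iff₀ hM0).2 hm0
  have hκ0 : 0 < κ := hδ.trans_le hκδ
  have hc0 : 0 ≤ 1 / κ ^ 2 := by positivity
  have hκκ : 1 / κ ^ 2 * κ ^ 2 = 1 := by
    rw [one_div, inv_mul_cancel₀ (by positivity)]
  refine ⟨ψ, hψ, 1 / κ ^ 2, hc0, ?_, fun x => ?_, fun x => ?_, ?_⟩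
  · exact one_div_le_one_div_of_le (by positivity) (pow_le_pow_left₀ hδ.le hκδ 2)
  · split_ifs with hx
    · rw [hψeq x hx, hκκ]
    · exact mul_nonneg hc0 (hψ0 x)
  · exact (mul_le_mul_of_nonneg_left (hψle x) hc0).trans hκκ.le
  · rw [Finset.expect_sub_distrib, ← Finset.mul_expect, hψE, expect_boole_mem,
      card_intervalFinset hNM, ZMod.card, ← mul_assoc, hκκ, one_mul, ← sub_div, div_le_iff₀ hM0]
    linarith

theorem cubeAvg_sub_one_le_of_gowersNorm_le {s : ℕ} {Z : Type*} [AddCommGroup Z] [Fintype Z]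
    (hs : s ≠ 0) {ν : Z → ℝ} {η : ℝ} (h : gowersNorm (2 * s) (fun x => ν x - 1) ≤ η) :
    cubeAvg (fun _ : Fin s ⊕ Fin s → Fin 2 => fun x => ν x - 1) ≤
      η ^ 2 ^ Fintype.card (Fin s ⊕ Fin s) := by
  have : Nonempty (Fin (2 * s)) := ⟨⟨0, by omega⟩⟩
  have he := cubeAvg_comp_equiv (finSumFinEquiv.trans (finCongr (two_mul s).symm))
    (fun _ : (Fin s ⊕ Fin s → Fin 2) => fun x => ν x - 1)
  have hcard : Fintype.card (Fin s ⊕ Fin s) = 2 * s := by simp [two_mul]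
  rw [← he, hcard]
  rw [gowersNorm_eq_cubeAvg] at h
  set u := cubeAvg (fun _ : Fin (2 * s) → Fin 2 => fun x => ν x - 1) with hu
  have hu0 : 0 ≤ u := cubeAvg_const_nonneg _
  have h1 := pow_le_pow_left₀ (Real.rpow_nonneg hu0 _) h (2 ^ (2 * s))
  refine le_trans (le_of_eq ?_) h1
  have h2 := Real.rpow_inv_natCast_pow hu0 (pow_ne_zero (2 * s) two_ne_zero : 2 ^ (2 * s) ≠ 0)
  rw [one_div]
  exact_mod_cast h2.symm

/-- The dense model theorem for nonnegative functions on an interval. -/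
theorem exists_interval_model {s : ℕ} (hs : 2 ≤ s) {ε : ℝ} (hε : 0 < ε) (hε1 : ε ≤ 1) :
    ∃ N₀ : ℕ, ∃ δ : ℝ, 0 < δ ∧ ∀ N M : ℕ, ∀ [NeZero M], N₀ ≤ M → N < M →
      ∀ ν : ZMod M → ℝ, (∀ x, 0 ≤ ν x) →
        cubeAvg (fun _ : Fin s ⊕ Fin s → Fin 2 => fun x => ν x - 1) ≤
          δ ^ 2 ^ Fintype.card (Fin s ⊕ Fin s) →
        ∀ f : Finset.Icc 1 N → ℝ, (∀ n, 0 ≤ f n) → (∀ x, extendInterval M f x ≤ ν x) →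
          ∃ h : Finset.Icc 1 N → ℝ, (∀ n, 0 ≤ h n) ∧ (∀ n, h n ≤ 1) ∧
            ∀ φ ∈ dualHull (Fin s) (ZMod M),
              |𝔼 x, (extendInterval M f x - extendInterval M h x) * φ x| ≤ ε := by
  have : Nonempty (Fin s) := ⟨⟨0, by omega⟩⟩
  have hij : (⟨0, by omega⟩ : Fin s) ≠ ⟨1, by omega⟩ := by simp
  obtain ⟨δ, hδ0, hδ1, H⟩ := exists_dense_model (Fin s) hε
    (by positivity : 0 ≤ 1 / (ε / 16) ^ 2)
  refine ⟨⌈1 / (ε / 16)⌉₊, δ, hδ0, ?_⟩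
  intro N M _ hM hNM ν hν0 hν f hf hfν
  obtain ⟨ψ, hψ, c, hc, hcL, hJψ, hψ1, hψE⟩ := exists_interval_majorant hij
    (δ := ε / 16) (by positivity) (by linarith [hε1]) hNM (Nat.ceil_le.1 hM)
  set J : ZMod M → ℝ := fun x => if x ∈ intervalFinset N M then 1 else 0 with hJ
  obtain ⟨g, hg0, hgJ, hg⟩ := H (ZMod M) ν (extendInterval M f) J ψ c hν0 hν hψ hc hcL
    (fun x => by simp only [hJ]; split_ifs <;> norm_num) hJψ hψ1 (by linarith)
    (fun x => by unfold extendInterval; split_ifs; exacts [hf _, le_rfl])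
    (fun x => by
      by_cases hx : x ∈ intervalFinset N M
      · simpa [hJ, hx] using hfν x
      · have hx' := (mem_intervalFinset hNM).not.1 hx
        rw [extendInterval, dif_neg hx']
        simp [hJ, hx])
  have hJ1 : ∀ x, J x ≤ 1 := fun x => by simp only [hJ]; split_ifs <;> norm_num
  -- Since `0 ≤ g ≤ J`, the model vanishes off `[N]` and nothing is lost by restricting it.
  have hext : extendInterval M (fun n : Finset.Icc 1 N => g ((n : ℕ) : ZMod M)) = g := by
    funext x
    unfold extendInterval
    split_ifs with hx
    · simp
    · have h1 := hgJ x
      simp only [hJ, if_neg ((mem_intervalFinset hNM).not.2 hx)] at h1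
      exact le_antisymm (hg0 x) h1
  refine ⟨fun n => g ((n : ℕ) : ZMod M), fun n => hg0 _, fun n => (hgJ _).trans (hJ1 _), ?_⟩
  rw [hext]
  exact hg

end Transference

theorem corollary5p5 (s : ℕ) (hs : 2 ≤ s) (C : ℝ) (hC : 20 ≤ C)
    (ε : ℝ) (hε : 0 < ε) (hε1 : ε ≤ 1) :
    ∃ N₀ : ℕ, 0 < N₀ ∧ ∃ η : ℝ, 0 < η ∧
      ∀ N : ℕ, N₀ ≤ N →
      ∀ (N' : ℕ) [Fact N'.Prime], C * (N : ℝ) ≤ (N' : ℝ) → (N' : ℝ) ≤ 2 * C * (N : ℝ) →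
      ∀ ν : ZMod N' → ℝ, (∀ x, 0 ≤ ν x) →
        gowersNorm (2 * s) (fun x => ν x - 1) ≤ η →
      ∀ f : Finset.Icc 1 N → ℝ, (∀ n : Finset.Icc 1 N, |f n| ≤ ν ((n : ℕ) : ZMod N')) →
      ∃ h : Finset.Icc 1 N → ℝ,
        (∀ n, h n ∈ Set.Icc (-1 : ℝ) 1) ∧
        (∀ (M : ℕ) [NeZero M], 2 * N < M →
          gowersIntervalNorm M s (fun n => f n - h n) ≤ ε) ∧
        ((∀ n, 0 ≤ f n) → ∀ n, 0 ≤ h n) := by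
  have hs0 : s ≠ 0 := by omega
  have : Nonempty (Fin s) := ⟨⟨0, by omega⟩⟩
  -- The factor `2 * C` pays for the normalisation by the norm of `1_{[N]}`, and `2 ^ 2 ^ s` for
  -- halving `f - h`.
  set ε₁ : ℝ := (ε / (2 * C)) ^ 2 ^ s / 2 ^ 2 ^ s with hε₁
  have hC0 : 0 < 2 * C := by linarith
  have hε₁0 : 0 < ε₁ := by positivity
  obtain ⟨δ₁, hδ₁, hδ₁1, H₁⟩ := exists_forall_abs_cubeAvg_le (Fin s)
    (Finset.univ.erase (0 : Fin s → Fin 2)).card ε₁ hε₁0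
  obtain ⟨N₁, δ₂, hδ₂, H₂⟩ := exists_interval_model hs hδ₁ hδ₁1
  refine ⟨N₁ + 1, Nat.succ_pos _, min δ₁ δ₂, lt_min hδ₁ hδ₂, ?_⟩
  intro N hN N' _ hCN hCN' ν hν0 hν f hfν
  have hN0 : (0 : ℝ) < N := by exact_mod_cast (by omega : 0 < N)
  have hNN' : 2 * N < N' := by
    have : (2 * N : ℝ) < N' := by nlinarith
    exact_mod_cast this
  have hνU := cubeAvg_sub_one_le_of_gowersNorm_le hs0 hν
  have hmin0 : 0 ≤ min δ₁ δ₂ := (lt_min hδ₁ hδ₂).le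
  have hfν' : ∀ x, |extendInterval N' f x| ≤ ν x := by
    intro x
    unfold extendInterval
    split_ifs with hx
    · simpa using hfν ⟨x.val, hx⟩
    · simpa using hν0 x
  have hmodel : ∀ f' : Finset.Icc 1 N → ℝ, (∀ n, 0 ≤ f' n) → (∀ n, f' n ≤ |f n|) →
      ∃ h : Finset.Icc 1 N → ℝ, (∀ n, 0 ≤ h n) ∧ (∀ n, h n ≤ 1) ∧
        ∀ φ ∈ dualHull (Fin s) (ZMod N'),
          |𝔼 x, (extendInterval N' f' x - extendInterval N' h x) * φ x| ≤ δ₁ := by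
    intro f' hf0 hf'
    refine H₂ N N' (by omega) (by omega) ν hν0
      (hνU.trans (pow_le_pow_left₀ hmin0 (min_le_right _ _) _)) f' hf0 fun x => ?_
    refine le_trans ?_ (hfν' x)
    unfold extendInterval
    split_ifs with hx
    · exact hf' _
    · simp
  -- The tolerance `2 * δ₁` leaves room for two models; halving `f - h` restores `δ₁`.
  have hconcl : ∀ h : Finset.Icc 1 N → ℝ, (∀ n, |h n| ≤ 1) →
      (∀ φ ∈ dualHull (Fin s) (ZMod N'),
        |𝔼 x, (extendInterval N' f x - extendInterval N' h x) * φ x| ≤ 2 * δ₁) →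
      ∀ (M : ℕ) [NeZero M], 2 * N < M → gowersIntervalNorm M s (fun n => f n - h n) ≤ ε := by
    intro h hh hweak M _ hM
    rw [gowersIntervalNorm_eq_of_lt hM hNN' hs0]
    refine gowersIntervalNorm_le hs0 (by omega) (by omega) hε.le hC0 hCN' _ ?_
    have hg : extendInterval N' (fun n => f n - h n) = fun x =>
        2 * (1 / 2 * (extendInterval N' f x - extendInterval N' h x)) := by
      funext x
      rw [extendInterval_sub]
      ring
    have hh' : ∀ x, |extendInterval N' h x| ≤ 1 := by
      intro x
      unfold extendInterval
      split_ifs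
      · exact hh _
      · simp
    have hden : cubeAvg (fun _ : Fin s → Fin 2 => fun x =>
        1 / 2 * (extendInterval N' f x - extendInterval N' h x)) ≤ ε₁ := by
      refine (le_abs_self _).trans (H₁ (ZMod N') (fun x => (ν x + 1) / 2) _ ?_ (fun x => ?_)
        (fun F hF => ?_) 0 (Finset.univ.erase 0) _ (by simp) rfl rfl (fun ω _ x => ?_)
        (fun ω hω hω0 => absurd (Finset.mem_erase.2 ⟨hω0, Finset.mem_univ ω⟩) hω))
      · have heq : (fun x => (ν x + 1) / 2 - 1) = fun x => 1 / 2 * (ν x - 1) := by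
          funext x; ring
        rw [heq, cubeAvg_const_mul]
        refine le_trans ?_ (hνU.trans (pow_le_pow_left₀ hmin0 (min_le_left _ _) _))
        exact mul_le_of_le_one_left (cubeAvg_const_nonneg _)
          (pow_le_one₀ (by norm_num) (by norm_num))
      · rw [abs_mul, abs_of_pos (by norm_num : (0 : ℝ) < 1 / 2)]
        have := (abs_sub _ _).trans (add_le_add (hfν' x) (hh' x))
        linarith
      · have h1 := hweak _ (dualFun_mem_dualHull hF)
        have h2 : 𝔼 x, 1 / 2 * (extendInterval N' f x - extendInterval N' h x) * dualFun F x =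
            1 / 2 * 𝔼 x, (extendInterval N' f x - extendInterval N' h x) * dualFun F x := by
          rw [Finset.mul_expect]
          exact Finset.expect_congr rfl fun x _ => mul_assoc _ _ _
        rw [h2, abs_mul, abs_of_pos (by norm_num : (0 : ℝ) < 1 / 2)]
        linarith
      · rw [abs_mul, abs_of_pos (by norm_num : (0 : ℝ) < 1 / 2)]
        have := (abs_sub _ _).trans (add_le_add (hfν' x) (hh' x))
        linarith
    rw [hg, cubeAvg_const_mul, Fintype.card_fin]
    calc _ ≤ 2 ^ 2 ^ s * ε₁ := mul_le_mul_of_nonneg_left hden (by positivity)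
      _ = _ := by rw [hε₁]; field_simp
  by_cases hf0 : ∀ n, 0 ≤ f n
  · obtain ⟨h, hh0, hh1, hh⟩ := hmodel f hf0 fun n => le_abs_self _
    refine ⟨h, fun n => ⟨by linarith [hh0 n], hh1 n⟩, ?_, fun _ => hh0⟩
    exact hconcl h (fun n => abs_le.2 ⟨by linarith [hh0 n], hh1 n⟩)
      fun φ hφ => (hh φ hφ).trans (by linarith)
  -- For signed `f`, the positive and negative parts are modelled separately; a difference of two
  -- functions valued in `[0, 1]` lies in `[-1, 1]`.
  · obtain ⟨h₁, hh₁0, hh₁1, hh₁⟩ := hmodel (fun n => max (f n) 0) (fun n => le_max_right _ _)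
      (fun n => max_le (le_abs_self _) (abs_nonneg _))
    obtain ⟨h₂, hh₂0, hh₂1, hh₂⟩ := hmodel (fun n => max (-f n) 0) (fun n => le_max_right _ _)
      (fun n => max_le (neg_le_abs _) (abs_nonneg _))
    have hb : ∀ n, -1 ≤ h₁ n - h₂ n ∧ h₁ n - h₂ n ≤ 1 := fun n =>
      ⟨by linarith [hh₁0 n, hh₂1 n], by linarith [hh₁1 n, hh₂0 n]⟩
    refine ⟨fun n => h₁ n - h₂ n, hb, ?_, fun h => absurd h hf0⟩
    refine hconcl _ (fun n => abs_le.2 (hb n)) fun φ hφ => ?_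
    have hsplit : f = fun n => max (f n) 0 - max (-f n) 0 := by
      funext n
      rcases le_total 0 (f n) with h | h
      · rw [max_eq_left h, max_eq_right (by linarith), sub_zero]
      · rw [max_eq_right h, max_eq_left (by linarith)]; ring
    have heq : 𝔼 x, (extendInterval N' f x - extendInterval N' (fun n => h₁ n - h₂ n) x) * φ x =
        (𝔼 x, (extendInterval N' (fun n => max (f n) 0) x - extendInterval N' h₁ x) * φ x) -
        𝔼 x, (extendInterval N' (fun n => max (-f n) 0) x - extendInterval N' h₂ x) * φ x := by
      rw [← Finset.expect_sub_distrib]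
      refine Finset.expect_congr rfl fun x _ => ?_
      conv_lhs => rw [hsplit]
      rw [extendInterval_sub, extendInterval_sub]
      ring
    rw [heq]
    refine (abs_sub _ _).trans ?_
    linarith [hh₁ φ hφ, hh₂ φ hφ]
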